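/- Let $M$ be a von Neumann algebra acting on a complex Hilbert space $H$, with a cyclic and separating vector $\xi$. Put $\Xi = M'\xi$ and let $S_\xi$ be the Tomita--Takesaki operator, i.e. the closure of the conjugate-linear operator $x\xi \mapsto x^*\xi$ ($x\in M$). Inner products are linear in the second argument; $\odot$ denotes the linear (algebraic) tensor product realised inside the Hilbert space tensor product $\otimes$; $\mathbb{C}\otimes H$ is identified with $H$. For Hilbert spaces $E, F$ let $\mathrm{Op}_M(E\odot\Xi; F\otimes H)$ be the linear space of operators $T$ from $E\otimes H$ to $F\otimes H$ with domain $E\odot\Xi$ such that $(I\otimes u^*)T(I\otimes u)=T$ for all unitaries $u\in M'$. Let $\mathrm{Mat}_{E;F}$ be the space of those $T\in \mathrm{Op}_M(E\odot\Xi;F\otimes H)$ for which the operator $TE_\xi: c\mapsto T(c\otimes\xi)$ is Hilbert--Schmidt from $E$ to $F\otimes H$. Let $\mathrm{Mat}^\ddagger_{E;F}$ be the space of those $T\in\mathrm{Mat}_{E;F}$ for which $\mathrm{Dom}\,T^*\supset F\odot\Xi$ and $T^\dagger := T^*|_{F\odot\Xi}$ belongs to $\mathrm{Mat}_{F;E}$.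 Put $\mathrm{Col}_F=\mathrm{Mat}_{\mathbb{C};F}$, $\mathrm{Row}_E=\mathrm{Mat}_{E;\mathbb{C}}$ and $\mathrm{Col}^\ddagger_F=\mathrm{Mat}^\ddagger_{\mathbb{C};F}$. Suppose that $E$ and $F$ carry conjugations $c\mapsto\overline{c}$ (they are complexifications of real Hilbert spaces). The transpose of $T\in\mathrm{Mat}_{E;F}$ is $T^\top := ((TE_\xi)_\top)^\xi$, where, for a Hilbert--Schmidt operator $B:E\to F\otimes H$, the Hilbert--Schmidt operator $B_\top: F\to E\otimes H$ is determined by $\langle c\otimes v, B_\top d\rangle = \langle \overline{d}\otimes v, B\overline{c}\rangle$ ($c\in E$, $d\in F$, $v\in H$) and, for an operator $B: F\to E\otimes H$, $B^\xi$ is the operator with domain $F\odot\Xi$ given by $d\otimes x'\xi\mapsto (I\otimes x')Bd$ ($x'\in M'$). The conjugate of $T\in\mathrm{Mat}^\ddagger_{E;F}$ is $\overline{T} := (T^\dagger)^\top$. Let $k$ be a Hilbert space with a conjugation, also denoted by $k$, let $\hat k=\mathbb{C}\oplus k$ and let $k\oplus k$ carry the conjugation $k\oplus k$. Let $\pi$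 denote the sum-flips on $k\oplus k$ and on $(k\oplus k)\otimes H=(k\otimes H)\oplus(k\otimes H)$, and put $k^\pi=(k\oplus k)\circ\pi$. Let $$\mathrm{Mat}_{\hat k,0}=\Big\{\begin{bmatrix}0&R\\C&0\end{bmatrix}: C\in\mathrm{Col}_k,\ R\in\mathrm{Row}_k\Big\},\qquad \mathrm{Mat}^\ddagger_{\hat k,0}=\mathrm{Mat}_{\hat k,0}\cap\mathrm{Mat}^\ddagger_{\hat k;\hat k}.$$ Then $\mathrm{Col}_{k\oplus k}=\mathrm{Op}_M(\Xi;(k\oplus k)\otimes H)$, and the map $$\mathrm{Mat}_{\hat k,0}\to\mathrm{Col}_{k\oplus k},\qquad T=\begin{bmatrix}0&R\\C&0\end{bmatrix}\mapsto \mathrm{col}\,T=\begin{bmatrix}C\\R^\top\end{bmatrix}$$ is a (well-defined) linear isomorphism. It restricts to an isomorphism $\mathrm{Mat}^\ddagger_{\hat k,0}\to\mathrm{Col}^\ddagger_{k\oplus k}$. Moreover, for every $T\in\mathrm{Mat}^\ddagger_{\hat k,0}$, the matrices $T^\dagger$ and $\overline{T}$ belong to $\mathrm{Mat}^\ddagger_{\hat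 k,0}$, $$\mathrm{col}\,T^\dagger=\pi\circ\mathrm{col}\,\overline{T},\qquad \mathrm{col}\,\overline{T}=\overline{\mathrm{col}\,T},$$ and $(\mathrm{col}\,T)\xi$ is in the domain of $k^\pi\otimes S_\xi$ (the closure of the linear tensor product $k^\pi\odot S_\xi$) with $$(\mathrm{col}\,T^\dagger)\xi=(k^\pi\otimes S_\xi)(\mathrm{col}\,T)\xi .$$ -/

import Mathlib

open scoped TensorProduct InnerProductSpace

noncomputable section

namespace AffMat

universe u v w

/-! ### Hilbert space tensor products and ampliations -/

section Tensor

/-- The Hilbert space tensor product `E ⊗ F`: the completion of the algebraic tensor product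
with respect to the inner product `⟪a ⊗ b, c ⊗ d⟫ = ⟪a, c⟫ ⟪b, d⟫`. -/
def HT (E : Type*) (F : Type*) [NormedAddCommGroup E] [InnerProductSpace ℂ E]
    [NormedAddCommGroup F] [InnerProductSpace ℂ F] : Type _ :=
  UniformSpace.Completion (E ⊗[ℂ] F)

variable {E : Type*} [NormedAddCommGroup E] [InnerProductSpace ℂ E]
  {E' : Type*} [NormedAddCommGroup E'] [InnerProductSpace ℂ E']
  {F : Type*} [NormedAddCommGroup F] [InnerProductSpace ℂ F]
  {F' : Type*} [NormedAddCommGroup F'] [InnerProductSpace ℂ F']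

instance : NormedAddCommGroup (HT E F) :=
  inferInstanceAs (NormedAddCommGroup (UniformSpace.Completion (E ⊗[ℂ] F)))

instance : InnerProductSpace ℂ (HT E F) :=
  inferInstanceAs (InnerProductSpace ℂ (UniformSpace.Completion (E ⊗[ℂ] F)))

instance : CompleteSpace (HT E F) :=
  inferInstanceAs (CompleteSpace (UniformSpace.Completion (E ⊗[ℂ] F)))

/-- The embedding of the algebraic tensor product into `E ⊗ F`. -/
def toHT (E : Type*) (F : Type*) [NormedAddCommGroup E] [InnerProductSpace ℂ E]
    [NormedAddCommGroup F] [InnerProductSpace ℂ F] : E ⊗[ℂ] F →ₗᵢ[ℂ] HT E F :=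
  UniformSpace.Completion.toComplₗᵢ (𝕜 := ℂ) (E := E ⊗[ℂ] F)

theorem denseRange_toHT : DenseRange (toHT E F) :=
  UniformSpace.Completion.denseRange_coe (α := E ⊗[ℂ] F)

/-- The simple tensor `c ⊗ v` in `E ⊗ F`. -/
def tmul (c : E) (v : F) : HT E F := toHT E F (c ⊗ₜ[ℂ] v)

/-- `c ⊗ v` as a bounded operator in `v`, that is, `|c⟩ ⊗ I`. -/
def tmulL (F : Type*) [NormedAddCommGroup F] [InnerProductSpace ℂ F] (c : E) : F →L[ℂ] HT E F :=
  (toHT E F).toContinuousLinearMap ∘L TensorProduct.mkL ℂ E F c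

/-- `⟨c| ⊗ I`, the bounded operator from `E ⊗ F` to `F` with `d ⊗ v ↦ ⟪c, d⟫ v`. -/
def slice (F : Type*) [NormedAddCommGroup F] [InnerProductSpace ℂ F] [CompleteSpace F] (c : E) :
    HT E F →L[ℂ] F :=
  ContinuousLinearMap.adjoint (tmulL F c)

/-- The bounded operator `A ⊗ x`. -/
def htMap (A : E →L[ℂ] E') (x : F →L[ℂ] F') : HT E F →L[ℂ] HT E' F' :=
  (TensorProduct.mapL A x).completion

theorem htMap_toHT (A : E →L[ℂ] E') (x : F →L[ℂ] F') (t : E ⊗[ℂ] F) :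
    htMap A x (toHT E F t) = toHT E' F' (TensorProduct.mapL A x t) :=
  ContinuousLinearMap.completion_apply_coe _ t

/-- Bounded operators which agree on the algebraic tensor product are equal. -/
theorem ht_ext {Y : Type*} [NormedAddCommGroup Y] [InnerProductSpace ℂ Y]
    {A B : HT E F →L[ℂ] Y} (h : ∀ t, A (toHT E F t) = B (toHT E F t)) : A = B :=
  ContinuousLinearMap.coeFn_injective
    (denseRange_toHT.equalizer A.continuous B.continuous (funext h))

/-- The canonical map of the algebraic tensor product `E ⊗ D`, for a subspace `D` of `F`, into the
Hilbert space `E ⊗ F`. -/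
def algTensorMap (E : Type*) [NormedAddCommGroup E] [InnerProductSpace ℂ E]
    (D : Submodule ℂ F) : (E ⊗[ℂ] D) →ₗ[ℂ] HT E F :=
  (toHT E F).toLinearMap ∘ₗ D.subtype.lTensor E

theorem algTensorMap_injective (D : Submodule ℂ F) : Function.Injective (algTensorMap E D) :=
  (toHT E F).injective.comp
    (Module.Flat.lTensor_preserves_injective_linearMap D.subtype D.subtype_injective)

/-- The linear tensor product of `E` and the subspace `D` of `F`, realised in the Hilbert
space `E ⊗ F`: the linear span of the vectors `c ⊗ d` with `c ∈ E`, `d ∈ D`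
(see `algTensor_eq_span`). -/
def algTensor (E : Type*) [NormedAddCommGroup E] [InnerProductSpace ℂ E]
    (D : Submodule ℂ F) : Submodule ℂ (HT E F) :=
  LinearMap.range (algTensorMap E D)

/-- The identification of `algTensor E D` with the algebraic tensor product. -/
def algTensorEquiv (E : Type*) [NormedAddCommGroup E] [InnerProductSpace ℂ E]
    (D : Submodule ℂ F) : (E ⊗[ℂ] D) ≃ₗ[ℂ] algTensor E D :=
  LinearEquiv.ofInjective (algTensorMap E D) (algTensorMap_injective D)

theorem inner_tmul (c d : E) (v w : F) : ⟪tmul c v, tmul d w⟫_ℂ = ⟪c, d⟫_ℂ * ⟪v, w⟫_ℂ := by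
  rw [tmul, tmul, LinearIsometry.inner_map_map, TensorProduct.inner_tmul]

theorem norm_tmul (c : E) (v : F) : ‖tmul c v‖ = ‖c‖ * ‖v‖ := by
  rw [tmul, LinearIsometry.norm_map, TensorProduct.norm_tmul]

theorem add_tmul (c d : E) (v : F) : tmul (c + d) v = tmul c v + tmul d v := by
  rw [tmul, TensorProduct.add_tmul, map_add]; rfl

theorem tmul_add (c : E) (v w : F) : tmul c (v + w) = tmul c v + tmul c w :=
  (tmulL F c).map_add v w

theorem smul_tmul (a : ℂ) (c : E) (v : F) : tmul (a • c) v = a • tmul c v := by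
  rw [tmul, ← TensorProduct.smul_tmul', map_smul]; rfl

theorem tmul_smul (a : ℂ) (c : E) (v : F) : tmul c (a • v) = a • tmul c v :=
  (tmulL F c).map_smul a v

theorem htMap_tmul (A : E →L[ℂ] E') (x : F →L[ℂ] F') (c : E) (v : F) :
    htMap A x (tmul c v) = tmul (A c) (x v) := by
  rw [tmul, htMap_toHT, TensorProduct.mapL_tmul]; rfl

theorem htMap_add_right (A : E →L[ℂ] E') (x y : F →L[ℂ] F') :
    htMap A (x + y) = htMap A x + htMap A y := by
  refine ht_ext fun t => ?_
  change _ = htMap A x _ + htMap A y _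
  rw [htMap_toHT, htMap_toHT, htMap_toHT, TensorProduct.mapL_add_right, ← map_add]
  rfl

theorem htMap_smul_right (A : E →L[ℂ] E') (a : ℂ) (x : F →L[ℂ] F') :
    htMap A (a • x) = a • htMap A x := by
  refine ht_ext fun t => ?_
  change _ = a • htMap A x _
  rw [htMap_toHT, htMap_toHT, TensorProduct.mapL_smul_right, ← map_smul]
  rfl

theorem htMap_id : htMap (ContinuousLinearMap.id ℂ E) (ContinuousLinearMap.id ℂ F) =
    ContinuousLinearMap.id ℂ (HT E F) := by
  refine ht_ext fun t => ?_
  rw [htMap_toHT, TensorProduct.mapL_id_id]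
  rfl

theorem htMap_comp_right (x y : F →L[ℂ] F) (z : HT E F) :
    htMap (ContinuousLinearMap.id ℂ E) x (htMap (ContinuousLinearMap.id ℂ E) y z) =
      htMap (ContinuousLinearMap.id ℂ E) (x * y) z := by
  have h : htMap (ContinuousLinearMap.id ℂ E) x ∘L htMap (ContinuousLinearMap.id ℂ E) y =
      htMap (ContinuousLinearMap.id ℂ E) (x * y) := by
    refine ht_ext fun t => ?_
    rw [ContinuousLinearMap.comp_apply, htMap_toHT, htMap_toHT, htMap_toHT]
    congr 1
    exact (congrArg (fun A => A t) (TensorProduct.mapL_comp (ContinuousLinearMap.id ℂ E)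
      (ContinuousLinearMap.id ℂ E) x y)).symm
  exact congrArg (fun A => A z) h

theorem tmul_mem_algTensor (D : Submodule ℂ F) (c : E) {d : F} (hd : d ∈ D) :
    tmul c d ∈ algTensor E D :=
  ⟨c ⊗ₜ ⟨d, hd⟩, rfl⟩

theorem algTensor_eq_span (D : Submodule ℂ F) :
    algTensor E D = Submodule.span ℂ {z | ∃ c : E, ∃ d ∈ D, z = tmul c d} := by
  apply le_antisymm
  · rintro _ ⟨t, rfl⟩
    induction t using TensorProduct.induction_on with
    | zero => rw [map_zero]; exact zero_mem _
    | tmul c d => exact Submodule.subset_span ⟨c, d, d.2, rfl⟩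
    | add x y hx hy => rw [map_add]; exact add_mem hx hy
  · rw [Submodule.span_le]
    rintro _ ⟨c, d, hd, rfl⟩
    exact tmul_mem_algTensor D c hd

theorem htMap_mem_algTensor {D : Submodule ℂ F} {D' : Submodule ℂ F'} (A : E →L[ℂ] E')
    (x : F →L[ℂ] F') (hx : ∀ d ∈ D, x d ∈ D') {z : HT E F} (hz : z ∈ algTensor E D) :
    htMap A x z ∈ algTensor E' D' := by
  rw [algTensor_eq_span] at hz
  induction hz using Submodule.span_induction with
  | mem z hz =>
    obtain ⟨c, d, hd, rfl⟩ := hz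
    rw [htMap_tmul]
    exact tmul_mem_algTensor D' _ (hx d hd)
  | zero => simp
  | add x y _ _ hx hy => rw [map_add]; exact add_mem hx hy
  | smul a x _ hx => rw [map_smul]; exact Submodule.smul_mem _ a hx

/-- The restriction of `A ⊗ I` to a map between the linear tensor products with `D`. -/
def algAmp (A : E →L[ℂ] E') (D : Submodule ℂ F) : algTensor E D →ₗ[ℂ] algTensor E' D :=
  (htMap A (ContinuousLinearMap.id ℂ F)).toLinearMap.restrict
    (fun _ hz => htMap_mem_algTensor A _ (fun _ hd => hd) hz)

end Tensor

/-! ### Unbounded operators with a prescribed domain; adjoints -/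

section Unbounded

variable {X : Type*} [NormedAddCommGroup X] [InnerProductSpace ℂ X] [CompleteSpace X]
  {Y : Type*} [NormedAddCommGroup Y] [InnerProductSpace ℂ Y]

/-- An operator with domain `D`, as an unbounded operator. -/
def toPMap {D : Submodule ℂ X} (T : D →ₗ[ℂ] Y) : X →ₗ.[ℂ] Y := ⟨D, T⟩

/-- `Op‡(D₁, D₂)`: the operators with domain `D₁` whose adjoint is defined on `D₂`. -/
def OpDag (D₁ : Submodule ℂ X) (D₂ : Submodule ℂ Y) : Submodule ℂ (D₁ →ₗ[ℂ] Y) where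
  carrier := {T | D₂ ≤ (toPMap T).adjoint.domain}
  zero_mem' := fun y _ => by
    rw [LinearPMap.mem_adjoint_domain_iff]
    have h : ((innerₛₗ ℂ y).comp (toPMap (0 : D₁ →ₗ[ℂ] Y)).toFun) = 0 := by
      ext z; exact inner_zero_right y
    rw [h]
    exact continuous_zero
  add_mem' := fun {S T} hS hT y hy => by
    have h1 := (LinearPMap.mem_adjoint_domain_iff (toPMap S) y).1 (hS hy)
    have h2 := (LinearPMap.mem_adjoint_domain_iff (toPMap T) y).1 (hT hy)
    rw [LinearPMap.mem_adjoint_domain_iff]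
    have h : (fun x : D₁ => ⟪y, (S + T) x⟫_ℂ) =
        fun x : D₁ => ⟪y, S x⟫_ℂ + ⟪y, T x⟫_ℂ := by
      ext x; exact inner_add_right y (S x) (T x)
    change Continuous (fun x : D₁ => ⟪y, (S + T) x⟫_ℂ)
    rw [h]
    exact Continuous.add h1 h2
  smul_mem' := fun a T hT y hy => by
    have h2 := (LinearPMap.mem_adjoint_domain_iff (toPMap T) y).1 (hT hy)
    rw [LinearPMap.mem_adjoint_domain_iff]
    have h : (fun x : D₁ => ⟪y, (a • T) x⟫_ℂ) = fun x : D₁ => a • ⟪y, T x⟫_ℂ := by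
      ext x; exact inner_smul_right y (T x) a
    change Continuous (fun x : D₁ => ⟪y, (a • T) x⟫_ℂ)
    rw [h]
    exact Continuous.const_smul h2 a

/-- `T† = T*|_{D₂}` for `T ∈ Op‡(D₁, D₂)`. -/
def dagger {D₁ : Submodule ℂ X} {D₂ : Submodule ℂ Y} (T : OpDag D₁ D₂) : D₂ →ₗ[ℂ] X :=
  (toPMap (T : D₁ →ₗ[ℂ] Y)).adjoint.toFun ∘ₗ Submodule.inclusion T.2

theorem dagger_of_not_dense {D₁ : Submodule ℂ X} {D₂ : Submodule ℂ Y}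
    (hD : ¬ Dense (D₁ : Set X)) (T : OpDag D₁ D₂) : dagger T = 0 := by
  ext y
  exact LinearPMap.adjoint_apply_of_not_dense hD _

theorem inner_dagger {D₁ : Submodule ℂ X} {D₂ : Submodule ℂ Y} (hD : Dense (D₁ : Set X))
    (T : OpDag D₁ D₂) (y : D₂) (x : D₁) :
    ⟪dagger T y, (x : X)⟫_ℂ = ⟪(y : Y), (T : D₁ →ₗ[ℂ] Y) x⟫_ℂ :=
  LinearPMap.adjoint_isFormalAdjoint (T := toPMap (T : D₁ →ₗ[ℂ] Y)) hD _ x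

theorem dagger_zero {D₁ : Submodule ℂ X} {D₂ : Submodule ℂ Y} :
    dagger (0 : OpDag D₁ D₂) = 0 := by
  by_cases hD : Dense (D₁ : Set X)
  · ext y
    refine hD.eq_of_inner_left ℂ fun x hx => ?_
    rw [inner_dagger hD _ y ⟨x, hx⟩]
    simp
  · exact dagger_of_not_dense hD _

theorem dagger_add {D₁ : Submodule ℂ X} {D₂ : Submodule ℂ Y} (S T : OpDag D₁ D₂) :
    dagger (S + T) = dagger S + dagger T := by
  by_cases hD : Dense (D₁ : Set X)
  · ext y
    refine hD.eq_of_inner_left ℂ fun x hx => ?_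
    rw [LinearMap.add_apply, inner_add_left, inner_dagger hD _ y ⟨x, hx⟩,
      inner_dagger hD _ y ⟨x, hx⟩, inner_dagger hD _ y ⟨x, hx⟩]
    simp
  · simp [dagger_of_not_dense hD]

theorem dagger_smul {D₁ : Submodule ℂ X} {D₂ : Submodule ℂ Y} (a : ℂ) (T : OpDag D₁ D₂) :
    dagger (a • T) = (starRingEnd ℂ a) • dagger T := by
  by_cases hD : Dense (D₁ : Set X)
  · ext y
    refine hD.eq_of_inner_left ℂ fun x hx => ?_
    rw [LinearMap.smul_apply, inner_smul_left, inner_dagger hD _ y ⟨x, hx⟩,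
      inner_dagger hD _ y ⟨x, hx⟩]
    simp
  · simp [dagger_of_not_dense hD]

theorem dagger_mem_zero {D₁ : Submodule ℂ X} {D₂ : Submodule ℂ Y}
    (P : Submodule ℂ (D₂ →ₗ[ℂ] X)) :
    dagger (⟨0, zero_mem _⟩ : OpDag D₁ D₂) ∈ P := by
  have e : (⟨0, zero_mem _⟩ : OpDag D₁ D₂) = 0 := rfl
  rw [e, dagger_zero]
  exact zero_mem P

theorem dagger_mem_add {D₁ : Submodule ℂ X} {D₂ : Submodule ℂ Y}
    (P : Submodule ℂ (D₂ →ₗ[ℂ] X)) {S T : D₁ →ₗ[ℂ] Y} (hS : S ∈ OpDag D₁ D₂)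
    (hT : T ∈ OpDag D₁ D₂) (hS' : dagger ⟨S, hS⟩ ∈ P) (hT' : dagger ⟨T, hT⟩ ∈ P) :
    dagger (⟨S + T, add_mem hS hT⟩ : OpDag D₁ D₂) ∈ P := by
  have e : (⟨S + T, add_mem hS hT⟩ : OpDag D₁ D₂) = ⟨S, hS⟩ + ⟨T, hT⟩ := rfl
  rw [e, dagger_add]
  exact add_mem hS' hT'

theorem dagger_mem_smul {D₁ : Submodule ℂ X} {D₂ : Submodule ℂ Y}
    (P : Submodule ℂ (D₂ →ₗ[ℂ] X)) (a : ℂ) {T : D₁ →ₗ[ℂ] Y}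
    (hT : T ∈ OpDag D₁ D₂) (hT' : dagger ⟨T, hT⟩ ∈ P) :
    dagger (⟨a • T, Submodule.smul_mem _ a hT⟩ : OpDag D₁ D₂) ∈ P := by
  have e : (⟨a • T, Submodule.smul_mem _ a hT⟩ : OpDag D₁ D₂) = a • ⟨T, hT⟩ := rfl
  rw [e, dagger_smul]
  exact Submodule.smul_mem P _ hT'

end Unbounded

/-! ### Closures and tensor products of conjugate-linear operators -/

section ConjLinear

variable {X : Type*} [NormedAddCommGroup X] [InnerProductSpace ℂ X]
  {Y : Type*} [NormedAddCommGroup Y] [InnerProductSpace ℂ Y]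

/-- The graph of a conjugate-linear operator. -/
def conjGraph (A : X →ₛₗ.[starRingEnd ℂ] Y) : Set (X × Y) :=
  {p | ∃ h : p.1 ∈ A.domain, A ⟨p.1, h⟩ = p.2}

theorem conjGraph_closure_add (A : X →ₛₗ.[starRingEnd ℂ] Y) {p q : X × Y}
    (hp : p ∈ closure (conjGraph A)) (hq : q ∈ closure (conjGraph A)) :
    p + q ∈ closure (conjGraph A) := by
  refine map_mem_closure₂ continuous_add hp hq ?_
  rintro ⟨a, a'⟩ ⟨ha, ha'⟩ ⟨b, b'⟩ ⟨hb, hb'⟩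
  exact ⟨add_mem ha hb, (A.toFun.map_add ⟨a, ha⟩ ⟨b, hb⟩).trans (congrArg₂ _ ha' hb')⟩

theorem conjGraph_closure_smul (A : X →ₛₗ.[starRingEnd ℂ] Y) (z : ℂ) {p : X × Y}
    (hp : p ∈ closure (conjGraph A)) :
    (z • p.1, (starRingEnd ℂ z) • p.2) ∈ closure (conjGraph A) := by
  have hc : Continuous (fun p : X × Y => (z • p.1, (starRingEnd ℂ z) • p.2)) := by fun_prop
  refine map_mem_closure (f := fun p : X × Y => (z • p.1, (starRingEnd ℂ z) • p.2)) hc hp ?_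
  rintro ⟨a, a'⟩ ⟨ha, ha'⟩
  exact ⟨A.domain.smul_mem z ha,
    (A.toFun.map_smulₛₗ z ⟨a, ha⟩).trans (congrArg (fun y => (starRingEnd ℂ z) • y) ha')⟩

theorem conjGraph_closure_zero (A : X →ₛₗ.[starRingEnd ℂ] Y) :
    (0 : X × Y) ∈ closure (conjGraph A) :=
  subset_closure ⟨A.domain.zero_mem, A.toFun.map_zero⟩

/-- A conjugate-linear operator is closable if the closure of its graph is a graph. -/
def ConjClosable (A : X →ₛₗ.[starRingEnd ℂ] Y) : Prop :=
  ∀ y : Y, ((0 : X), y) ∈ closure (conjGraph A) → y = 0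

theorem ConjClosable.unique {A : X →ₛₗ.[starRingEnd ℂ] Y} (hA : ConjClosable A) {x : X} {y y' : Y}
    (h : (x, y) ∈ closure (conjGraph A)) (h' : (x, y') ∈ closure (conjGraph A)) : y = y' := by
  have h1 := conjGraph_closure_add A h (conjGraph_closure_smul A (-1) h')
  have h2 : (0, y - y') ∈ closure (conjGraph A) := by
    convert h1 using 1
    simp [sub_eq_add_neg]
  exact sub_eq_zero.1 (hA _ h2)

/-- The closure of a closable conjugate-linear operator: the operator whose graph is the closure
of the graph. -/
def conjClosureAux (A : X →ₛₗ.[starRingEnd ℂ] Y) (hA : ConjClosable A) :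
    X →ₛₗ.[starRingEnd ℂ] Y where
  domain :=
    { carrier := {x | ∃ y, (x, y) ∈ closure (conjGraph A)}
      zero_mem' := ⟨0, conjGraph_closure_zero A⟩
      add_mem' := fun ⟨y, hy⟩ ⟨y', hy'⟩ => ⟨y + y', conjGraph_closure_add A hy hy'⟩
      smul_mem' := fun z _ ⟨y, hy⟩ => ⟨(starRingEnd ℂ z) • y, conjGraph_closure_smul A z hy⟩ }
  toFun :=
    { toFun := fun x => Classical.choose x.2
      map_add' := fun x x' => hA.unique (Classical.choose_spec (x + x').2)
        (conjGraph_closure_add A (Classical.choose_spec x.2) (Classical.choose_spec x'.2))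
      map_smul' := fun z x => hA.unique (Classical.choose_spec (z • x).2)
        (conjGraph_closure_smul A z (Classical.choose_spec x.2)) }

open scoped Classical in
/-- The closure of a conjugate-linear operator (the operator itself if it is not closable). -/
def conjClosure (A : X →ₛₗ.[starRingEnd ℂ] Y) : X →ₛₗ.[starRingEnd ℂ] Y :=
  if hA : ConjClosable A then conjClosureAux A hA else A

variable {E : Type*} [NormedAddCommGroup E] [InnerProductSpace ℂ E]
  {E' : Type*} [NormedAddCommGroup E'] [InnerProductSpace ℂ E']

/-- The linear tensor product `J ⊗ A` of an everywhere defined conjugate-linear map `J` and a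
conjugate-linear operator `A`: its domain is the linear tensor product of `E` and `Dom A`, and
`c ⊗ x ↦ J c ⊗ A x`. -/
def conjAlgTensor (J : E →ₗ⋆[ℂ] E') (A : X →ₛₗ.[starRingEnd ℂ] Y) :
    HT E X →ₛₗ.[starRingEnd ℂ] HT E' Y where
  domain := algTensor E A.domain
  toFun := ((toHT E' Y).toLinearMap.comp
    (TensorProduct.map J A.toFun)).comp (algTensorEquiv E A.domain).symm.toLinearMap

/-- `J ⊗ A`, the closure of the linear tensor product. -/
def conjTensor (J : E →ₗ⋆[ℂ] E') (A : X →ₛₗ.[starRingEnd ℂ] Y) :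
    HT E X →ₛₗ.[starRingEnd ℂ] HT E' Y :=
  conjClosure (conjAlgTensor J A)

end ConjLinear

/-! ### Conjugations -/

section Conjugations

/-- A conjugation on a complex Hilbert space: an isometric conjugate-linear involution. A complex
Hilbert space with a conjugation is the same as the complexification of a real Hilbert space
(that of the fixed vectors). -/
structure Conjugation (E : Type*) [NormedAddCommGroup E] [InnerProductSpace ℂ E] where
  /-- the map `c ↦ c̄` -/
  conj : E ≃ₗᵢ⋆[ℂ] E
  conj_conj : ∀ c, conj (conj c) = c

theorem Conjugation.inner_conj {E : Type*} [NormedAddCommGroup E] [InnerProductSpace ℂ E]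
    (k : Conjugation E) (x y : E) : ⟪k.conj x, k.conj y⟫_ℂ = ⟪y, x⟫_ℂ := by
  have h1 : k.conj x + Complex.I • k.conj y = k.conj (x - Complex.I • y) := by
    rw [map_sub, k.conj.map_smulₛₗ, Complex.conj_I, neg_smul, sub_neg_eq_add]
  have h2 : k.conj x - Complex.I • k.conj y = k.conj (x + Complex.I • y) := by
    rw [map_add, k.conj.map_smulₛₗ, Complex.conj_I, neg_smul, sub_eq_add_neg]
  rw [← inner_conj_symm y x, inner_eq_sum_norm_sq_div_four, inner_eq_sum_norm_sq_div_four x y]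
  simp only [RCLike.I_to_complex]
  rw [h1, h2, ← map_add, ← map_sub]
  simp only [LinearIsometryEquiv.norm_map]
  have h4 : (starRingEnd ℂ) 4 = 4 := Complex.conj_ofNat 4
  simp [h4]
  ring

/-- Complex conjugation on `ℂ`. -/
def conjC : Conjugation ℂ where
  conj := starₗᵢ ℂ
  conj_conj := fun c => star_star c

/-- The Hilbert space direct sum `E ⊕ F`. -/
abbrev HSum (E : Type*) (F : Type*) [NormedAddCommGroup E] [InnerProductSpace ℂ E]
    [NormedAddCommGroup F] [InnerProductSpace ℂ F] : Type _ :=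
  WithLp 2 (E × F)

variable {E : Type*} [NormedAddCommGroup E] [InnerProductSpace ℂ E]
  {F : Type*} [NormedAddCommGroup F] [InnerProductSpace ℂ F]

/-- The direct sum of two conjugations. -/
def Conjugation.sum (k : Conjugation E) (l : Conjugation F) : Conjugation (HSum E F) where
  conj :=
    { toFun := fun z => WithLp.toLp 2 (k.conj z.fst, l.conj z.snd)
      invFun := fun z => WithLp.toLp 2 (k.conj z.fst, l.conj z.snd)
      left_inv := fun z => by
        apply WithLp.ofLp_injective 2; apply Prod.ext <;> simp [k.conj_conj, l.conj_conj]
      right_inv := fun z => by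
        apply WithLp.ofLp_injective 2; apply Prod.ext <;> simp [k.conj_conj, l.conj_conj]
      map_add' := fun x y => by
        apply WithLp.ofLp_injective 2; apply Prod.ext <;> simp
      map_smul' := fun a x => by
        apply WithLp.ofLp_injective 2; apply Prod.ext <;> simp [LinearIsometryEquiv.map_smulₛₗ]
      norm_map' := fun z => by simp [WithLp.prod_norm_eq_of_L2] }
  conj_conj := fun z => by
        apply WithLp.ofLp_injective 2; apply Prod.ext <;> simp [k.conj_conj, l.conj_conj]

/-- The embedding `E → E ⊕ F`. -/
def inL (E F : Type*) [NormedAddCommGroup E] [InnerProductSpace ℂ E]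
    [NormedAddCommGroup F] [InnerProductSpace ℂ F] : E →L[ℂ] HSum E F :=
  (WithLp.prodContinuousLinearEquiv 2 ℂ E F).symm.toContinuousLinearMap ∘L
    ContinuousLinearMap.inl ℂ E F

/-- The embedding `F → E ⊕ F`. -/
def inR (E F : Type*) [NormedAddCommGroup E] [InnerProductSpace ℂ E]
    [NormedAddCommGroup F] [InnerProductSpace ℂ F] : F →L[ℂ] HSum E F :=
  (WithLp.prodContinuousLinearEquiv 2 ℂ E F).symm.toContinuousLinearMap ∘L
    ContinuousLinearMap.inr ℂ E F

/-- The coordinate map `E ⊕ F → E`. -/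
def prL (E F : Type*) [NormedAddCommGroup E] [InnerProductSpace ℂ E]
    [NormedAddCommGroup F] [InnerProductSpace ℂ F] : HSum E F →L[ℂ] E :=
  WithLp.fstL 2 ℂ E F

/-- The coordinate map `E ⊕ F → F`. -/
def prR (E F : Type*) [NormedAddCommGroup E] [InnerProductSpace ℂ E]
    [NormedAddCommGroup F] [InnerProductSpace ℂ F] : HSum E F →L[ℂ] F :=
  WithLp.sndL 2 ℂ E F

/-- The sum-flip on `E ⊕ E`. -/
def sumFlip (E : Type*) [NormedAddCommGroup E] [InnerProductSpace ℂ E] :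
    HSum E E →L[ℂ] HSum E E :=
  (LinearIsometryEquiv.withLpProdComm 2 ℂ E E).toContinuousLinearEquiv.toContinuousLinearMap

/-- `k^π = (k ⊕ k) ∘ π`. -/
def Conjugation.pi (k : Conjugation E) : HSum E E →ₗ⋆[ℂ] HSum E E :=
  (k.sum k).conj.toLinearEquiv.toLinearMap.comp (sumFlip E).toLinearMap

end Conjugations

/-! ### Hilbert-Schmidt operators and their partial transposes -/

section HilbertSchmidt

variable {E : Type u} [NormedAddCommGroup E] [InnerProductSpace ℂ E]
  {X : Type v} [NormedAddCommGroup X] [InnerProductSpace ℂ X]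

/-- The Hilbert-Schmidt operators from `E` to `X`: the bounded operators `B` such that
`∑ ‖B eᵢ‖² < ∞` for every orthonormal basis `(eᵢ)` of `E`. -/
def HS (E : Type u) (X : Type v) [NormedAddCommGroup E] [InnerProductSpace ℂ E]
    [NormedAddCommGroup X] [InnerProductSpace ℂ X] : Submodule ℂ (E →ₗ[ℂ] X) where
  carrier := {B | Continuous B ∧
    ∀ (ι : Type u) (b : HilbertBasis ι ℂ E), Summable fun i => ‖B (b i)‖ ^ 2}
  zero_mem' := ⟨continuous_zero, fun ι b => by simp⟩
  add_mem' := fun {B B'} hB hB' => ⟨hB.1.add hB'.1, fun ι b => by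
    refine Summable.of_nonneg_of_le (fun i => by positivity) (fun i => ?_)
      (((hB.2 ι b).add (hB'.2 ι b)).mul_left 2)
    have h := norm_add_le (B (b i)) (B' (b i))
    have h0 := norm_nonneg ((B + B') (b i))
    rw [LinearMap.add_apply] at *
    nlinarith [sq_nonneg (‖B (b i)‖ - ‖B' (b i)‖)]⟩
  smul_mem' := fun a B hB => ⟨hB.1.const_smul a, fun ι b => by
    simpa [norm_smul, mul_pow] using (hB.2 ι b).mul_left (‖a‖ ^ 2)⟩

variable {G : Type w} [NormedAddCommGroup G] [InnerProductSpace ℂ G]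
  {H : Type v} [NormedAddCommGroup H] [InnerProductSpace ℂ H] [CompleteSpace H]

theorem inner_tmul_slice (c : E) (v : H) (z : HT E H) :
    ⟪v, slice H c z⟫_ℂ = ⟪tmul c v, z⟫_ℂ := by
  rw [slice, ContinuousLinearMap.adjoint_inner_right]
  rfl

theorem slice_add (c d : G) (z : HT G H) : slice H (c + d) z = slice H c z + slice H d z := by
  refine ext_inner_left ℂ fun v => ?_
  rw [inner_add_right, inner_tmul_slice, inner_tmul_slice, inner_tmul_slice, add_tmul,
    inner_add_left]

theorem slice_smul (a : ℂ) (c : G) (z : HT G H) :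
    slice H (a • c) z = (starRingEnd ℂ a) • slice H c z := by
  refine ext_inner_left ℂ fun v => ?_
  rw [inner_smul_right, inner_tmul_slice, inner_tmul_slice, smul_tmul, inner_smul_left]

theorem norm_slice_le (c : G) (z : HT G H) : ‖slice H c z‖ ≤ ‖c‖ * ‖z‖ := by
  have h1 : ‖slice H c‖ ≤ ‖c‖ := by
    rw [slice, LinearIsometryEquiv.norm_map]
    refine ContinuousLinearMap.opNorm_le_bound _ (norm_nonneg c) fun v => ?_
    exact (norm_tmul c v).le
  exact (ContinuousLinearMap.le_opNorm _ _).trans (by gcongr)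

/-- An orthonormal basis of `E`. -/
def stdBasis (E : Type u) [NormedAddCommGroup E] [InnerProductSpace ℂ E] [CompleteSpace E] :
    HilbertBasis (exists_hilbertBasis ℂ E).choose ℂ E :=
  (exists_hilbertBasis ℂ E).choose_spec.choose

variable [CompleteSpace E]

/-- For a Hilbert-Schmidt operator `B`, the vectors `ēᵢ ⊗ (⟨c̄| ⊗ I) B eᵢ` are summable. -/
theorem summable_transpose (k₁ : Conjugation E) (k₂ : Conjugation G) (B : HS E (HT G H)) (c : G) :
    Summable fun i => tmul (k₁.conj (stdBasis E i))
      (slice H (k₂.conj c) ((B : E →ₗ[ℂ] HT G H) (stdBasis E i))) := by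
  have hon : Orthonormal ℂ (fun i => k₁.conj (stdBasis E i)) := by
    have h := (stdBasis E).orthonormal
    refine ⟨fun i => by rw [LinearIsometryEquiv.norm_map]; exact h.1 i, fun i j hij => ?_⟩
    change ⟪k₁.conj (stdBasis E i), k₁.conj (stdBasis E j)⟫_ℂ = 0
    rw [k₁.inner_conj, h.2 hij.symm]
  have hof : OrthogonalFamily ℂ (fun _ => H) (fun i =>
      ({ toLinearMap := (tmulL H (k₁.conj (stdBasis E i))).toLinearMap
         norm_map' := fun v => by
          have h : ‖tmul (k₁.conj (stdBasis E i)) v‖ = ‖v‖ := by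
            rw [norm_tmul, hon.1 i, one_mul]
          exact h } : H →ₗᵢ[ℂ] HT E H)) := by
    intro i j hij v w
    have h : ⟪tmul (k₁.conj (stdBasis E i)) v, tmul (k₁.conj (stdBasis E j)) w⟫_ℂ = 0 := by
      rw [inner_tmul, hon.2 hij, zero_mul]
    exact h
  refine (hof.summable_iff_norm_sq_summable
    (fun i => slice H (k₂.conj c) ((B : E →ₗ[ℂ] HT G H) (stdBasis E i)))).2 ?_
  refine Summable.of_nonneg_of_le (fun i => by positivity) (fun i => ?_)
    ((B.2.2 _ (stdBasis E)).mul_left (‖c‖ ^ 2))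
  rw [← mul_pow]
  have h := norm_slice_le (k₂.conj c) ((B : E →ₗ[ℂ] HT G H) (stdBasis E i))
  rw [LinearIsometryEquiv.norm_map] at h
  gcongr

/-- The partial transpose `B_⊤` of a Hilbert-Schmidt operator `B : E → G ⊗ H`, an operator from
`G` to `E ⊗ H`. It is the operator with `⟪c ⊗ v, B_⊤ d⟫ = ⟪d̄ ⊗ v, B c̄⟫` (see `inner_hsTranspose`),
so that `(A ⊗ |η⟩)_⊤ = Aᵀ ⊗ |η⟩` for Hilbert-Schmidt `A : E → G`; in terms of an orthonormal
basis `(eᵢ)` of `E` it is `B_⊤ d = ∑ ēᵢ ⊗ (⟨d̄| ⊗ I) B eᵢ`. -/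
def hsTranspose (k₁ : Conjugation E) (k₂ : Conjugation G) (B : HS E (HT G H)) :
    G →ₗ[ℂ] HT E H where
  toFun c := ∑' i, tmul (k₁.conj (stdBasis E i))
      (slice H (k₂.conj c) ((B : E →ₗ[ℂ] HT G H) (stdBasis E i)))
  map_add' c d := by
    rw [← (summable_transpose k₁ k₂ B c).tsum_add (summable_transpose k₁ k₂ B d)]
    refine tsum_congr fun i => ?_
    rw [map_add, slice_add, tmul_add]
  map_smul' a c := by
    rw [RingHom.id_apply, ← (summable_transpose k₁ k₂ B c).tsum_const_smul a]
    refine tsum_congr fun i => ?_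
    rw [LinearIsometryEquiv.map_smulₛₗ, slice_smul, tmul_smul, Complex.conj_conj]

/-- The identity that characterises the partial transpose. -/
theorem inner_hsTranspose (k₁ : Conjugation E) (k₂ : Conjugation G) (B : HS E (HT G H))
    (c : E) (d : G) (v : H) :
    ⟪tmul c v, hsTranspose k₁ k₂ B d⟫_ℂ =
      ⟪tmul (k₂.conj d) v, (B : E →ₗ[ℂ] HT G H) (k₁.conj c)⟫_ℂ := by
  have h1 := (innerSL ℂ (tmul c v)).hasSum (summable_transpose k₁ k₂ B d).hasSum
  have h2 := (stdBasis E).hasSum_repr (k₁.conj c)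
  let B' : E →L[ℂ] HT G H := ⟨(B : E →ₗ[ℂ] HT G H), B.2.1⟩
  have h3 := (innerSL ℂ (tmul (k₂.conj d) v)).hasSum (B'.hasSum h2)
  refine h1.unique ?_
  convert! h3 using 1
  funext i
  have h4 : ⟪c, k₁.conj (stdBasis E i)⟫_ℂ = ⟪stdBasis E i, k₁.conj c⟫_ℂ := by
    rw [← k₁.inner_conj, k₁.conj_conj]
  change ⟪tmul c v, tmul (k₁.conj (stdBasis E i)) _⟫_ℂ =
    ⟪tmul (k₂.conj d) v, B' ((stdBasis E).repr (k₁.conj c) i • stdBasis E i)⟫_ℂ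
  rw [inner_tmul, inner_tmul_slice, map_smul, inner_smul_right, HilbertBasis.repr_apply_apply, h4]
  rfl

end HilbertSchmidt

/-! ### Von Neumann algebras with a cyclic and separating vector -/

section VonNeumann

variable {H : Type v} [NormedAddCommGroup H] [InnerProductSpace ℂ H] [CompleteSpace H]

/-- `ξ` is a cyclic and separating vector for `M`. -/
class IsCyclicSeparating (M : VonNeumannAlgebra H) (ξ : H) : Prop where
  cyclic : Dense {η : H | ∃ x ∈ M, η = x ξ}
  separating : ∀ x ∈ M, x ξ = 0 → x = 0

/-- The underlying subspace of `B(H)`. -/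
def vnSub (M : VonNeumannAlgebra H) : Submodule ℂ (H →L[ℂ] H) :=
  M.toStarSubalgebra.toSubalgebra.toSubmodule

/-- The map `x ↦ x ξ` from `M` to `H`. -/
def vnEval (M : VonNeumannAlgebra H) (ξ : H) : vnSub M →ₗ[ℂ] H :=
  (ContinuousLinearMap.apply ℂ H ξ).toLinearMap ∘ₗ (vnSub M).subtype

/-- The subspace `M ξ` of `H`. -/
def orbit (M : VonNeumannAlgebra H) (ξ : H) : Submodule ℂ H := LinearMap.range (vnEval M ξ)

theorem mem_orbit {M : VonNeumannAlgebra H} {ξ η : H} :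
    η ∈ orbit M ξ ↔ ∃ x ∈ M, η = x ξ := by
  constructor
  · rintro ⟨x, rfl⟩
    exact ⟨x, x.2, rfl⟩
  · rintro ⟨x, hx, rfl⟩
    exact ⟨⟨x, hx⟩, rfl⟩

/-- `Ξ = M' ξ`. -/
abbrev Xi (M : VonNeumannAlgebra H) (ξ : H) : Submodule ℂ H := orbit M.commutant ξ

variable (M : VonNeumannAlgebra H) (ξ : H)

theorem vector_mem_Xi : ξ ∈ Xi M ξ := mem_orbit.2 ⟨1, one_mem M.commutant, rfl⟩

theorem apply_mem_Xi {x : H →L[ℂ] H} (hx : x ∈ M.commutant) {η : H} (hη : η ∈ Xi M ξ) :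
    x η ∈ Xi M ξ := by
  obtain ⟨y, hy, rfl⟩ := mem_orbit.1 hη
  exact mem_orbit.2 ⟨x * y, mul_mem hx hy, rfl⟩

variable [hξ : IsCyclicSeparating M ξ]

theorem vnEval_injective : Function.Injective (vnEval M ξ) := by
  rw [injective_iff_map_eq_zero]
  intro x hx
  exact Subtype.ext (hξ.separating x x.2 hx)

theorem vnEval_commutant_injective : Function.Injective (vnEval M.commutant ξ) := by
  rw [injective_iff_map_eq_zero]
  intro y hy
  refine Subtype.ext (ContinuousLinearMap.coeFn_injective ?_)
  refine Continuous.ext_on hξ.cyclic (y : H →L[ℂ] H).continuous continuous_const ?_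
  rintro _ ⟨x, hx, rfl⟩
  have h := VonNeumannAlgebra.mem_commutant_iff.1 y.2 x hx
  have h' : (y : H →L[ℂ] H) (x ξ) = x ((y : H →L[ℂ] H) ξ) := (congrArg (fun z => z ξ) h).symm
  have hy' : (y : H →L[ℂ] H) ξ = 0 := hy
  rw [h', hy', map_zero]
  rfl

/-- The linear isomorphism `x ↦ x ξ` from `M` onto `M ξ`. -/
def orbitEquiv : vnSub M ≃ₗ[ℂ] orbit M ξ :=
  LinearEquiv.ofInjective (vnEval M ξ) (vnEval_injective M ξ)

/-- The linear isomorphism `x' ↦ x' ξ` from `M'` onto `Ξ`. -/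
def XiEquiv : vnSub M.commutant ≃ₗ[ℂ] Xi M ξ :=
  LinearEquiv.ofInjective (vnEval M.commutant ξ) (vnEval_commutant_injective M ξ)

/-- The adjoint operation on `M`, as a conjugate-linear map to `B(H)`. -/
def vnStar : vnSub M →ₗ⋆[ℂ] (H →L[ℂ] H) where
  toFun x := star (x : H →L[ℂ] H)
  map_add' x y := star_add (x : H →L[ℂ] H) y
  map_smul' a x := star_smul a (x : H →L[ℂ] H)

/-- The conjugate-linear operator with domain `M ξ` given by `x ξ ↦ x* ξ`. -/
def tomitaPre : H →ₛₗ.[starRingEnd ℂ] H where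
  domain := orbit M ξ
  toFun := ((ContinuousLinearMap.apply ℂ H ξ).toLinearMap.comp (vnStar M)).comp
    (orbitEquiv M ξ).symm.toLinearMap

theorem tomitaPre_apply {x : H →L[ℂ] H} (hx : x ∈ M) :
    tomitaPre M ξ ⟨x ξ, mem_orbit.2 ⟨x, hx, rfl⟩⟩ = (star x) ξ := by
  have h1 : (orbitEquiv M ξ).symm ⟨x ξ, mem_orbit.2 ⟨x, hx, rfl⟩⟩ = ⟨x, hx⟩ := by
    rw [LinearEquiv.symm_apply_eq]
    rfl
  change (star (((orbitEquiv M ξ).symm ⟨x ξ, mem_orbit.2 ⟨x, hx, rfl⟩⟩ : vnSub M) :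
    H →L[ℂ] H)) ξ = _
  rw [h1]

/-- The Tomita-Takesaki operator `S_ξ`: the closure of `x ξ ↦ x* ξ` (`x ∈ M`). -/
def tomita : H →ₛₗ.[starRingEnd ℂ] H := conjClosure (tomitaPre M ξ)

end VonNeumann

/-! ### Affiliated operators and matrix spaces -/

section Affiliated

variable {H : Type v} [NormedAddCommGroup H] [InnerProductSpace ℂ H] [CompleteSpace H]
  {E : Type*} [NormedAddCommGroup E] [InnerProductSpace ℂ E]
  {F : Type*} [NormedAddCommGroup F] [InnerProductSpace ℂ F]

/-- `I ⊗ x`. -/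
abbrev ampl (E : Type*) [NormedAddCommGroup E] [InnerProductSpace ℂ E] (x : H →L[ℂ] H) :
    HT E H →L[ℂ] HT E H :=
  htMap (ContinuousLinearMap.id ℂ E) x

/-- The operator `T` from `E ⊗ H` to `F ⊗ H`, with domain `D`, is affiliated to `M`:
`(I ⊗ u*) T (I ⊗ u) = T`, as an equality of unbounded operators, for all unitaries `u` in `M'`. -/
def IsAffiliated (M : VonNeumannAlgebra H) {D : Submodule ℂ (HT E H)} (T : D →ₗ[ℂ] HT F H) :
    Prop :=
  ∀ u ∈ M.commutant, u ∈ unitary (H →L[ℂ] H) → ∀ z : HT E H,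
    (ampl E u z ∈ D ↔ z ∈ D) ∧
      ∀ (hz : z ∈ D) (huz : ampl E u z ∈ D), ampl F (star u) (T ⟨ampl E u z, huz⟩) = T ⟨z, hz⟩

variable (M : VonNeumannAlgebra H) (ξ : H)

theorem ampl_mem_iff {u : H →L[ℂ] H} (hu : u ∈ M.commutant) (huu : u ∈ unitary (H →L[ℂ] H))
    (z : HT E H) : ampl E u z ∈ algTensor E (Xi M ξ) ↔ z ∈ algTensor E (Xi M ξ) := by
  have key : ∀ x ∈ M.commutant, ∀ z ∈ algTensor E (Xi M ξ),
      ampl E x z ∈ algTensor E (Xi M ξ) :=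
    fun x hx z hz => htMap_mem_algTensor _ _ (fun d hd => apply_mem_Xi M ξ hx hd) hz
  refine ⟨fun h => ?_, fun h => key u hu z h⟩
  have h1 := key (star u) (star_mem hu) _ h
  have h3 : star u * u = 1 := (Unitary.mem_iff.1 huu).1
  rw [htMap_comp_right, h3] at h1
  have h4 : htMap (ContinuousLinearMap.id ℂ E) (1 : H →L[ℂ] H) z = z :=
    congrArg (fun A => A z) htMap_id
  rwa [h4] at h1

/-- `Op_M(E ⊗ Ξ; F ⊗ H)`: the operators from `E ⊗ H` to `F ⊗ H` whose domain is the linear tensor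
product of `E` and `Ξ` and which are affiliated to `M`. -/
def OpM (E : Type*) [NormedAddCommGroup E] [InnerProductSpace ℂ E]
    (F : Type*) [NormedAddCommGroup F] [InnerProductSpace ℂ F] :
    Submodule ℂ (algTensor E (Xi M ξ) →ₗ[ℂ] HT F H) where
  carrier := {T | IsAffiliated M T}
  zero_mem' := fun u hu huu z => ⟨ampl_mem_iff M ξ hu huu z, fun _ _ => by simp⟩
  add_mem' := fun hS hT u hu huu z => ⟨ampl_mem_iff M ξ hu huu z, fun hz huz => by
    rw [LinearMap.add_apply, LinearMap.add_apply, map_add, (hS u hu huu z).2 hz huz,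
      (hT u hu huu z).2 hz huz]⟩
  smul_mem' := fun a T hT u hu huu z => ⟨ampl_mem_iff M ξ hu huu z, fun hz huz => by
    rw [LinearMap.smul_apply, LinearMap.smul_apply, map_smul, (hT u hu huu z).2 hz huz]⟩

/-- `Op_M(Ξ; F ⊗ H)`, with domain `Ξ` in `H` itself (rather than in `ℂ ⊗ H`): the operators `X`
from `H` to `F ⊗ H` with domain `Ξ` such that `(I ⊗ u*) X u = X` for all unitaries `u` in `M'`. -/
def OpMXi (F : Type*) [NormedAddCommGroup F] [InnerProductSpace ℂ F] :
    Submodule ℂ (Xi M ξ →ₗ[ℂ] HT F H) where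
  carrier := {X | ∀ (u : H →L[ℂ] H) (hu : u ∈ M.commutant), u ∈ unitary (H →L[ℂ] H) →
    ∀ η : Xi M ξ, ampl F (star u) (X ⟨u η, apply_mem_Xi M ξ hu η.2⟩) = X η}
  zero_mem' := fun u hu huu η => by simp
  add_mem' := fun hS hT u hu huu η => by
    rw [LinearMap.add_apply, LinearMap.add_apply, map_add, hS u hu huu η, hT u hu huu η]
  smul_mem' := fun a T hT u hu huu η => by
    rw [LinearMap.smul_apply, LinearMap.smul_apply, map_smul, hT u hu huu η]

/-- The identification of `Ξ` with the linear tensor product of `ℂ` and `Ξ`: `η ↦ 1 ⊗ η`. -/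
def unitEquiv : Xi M ξ ≃ₗ[ℂ] algTensor ℂ (Xi M ξ) :=
  (TensorProduct.lid ℂ (Xi M ξ)).symm.trans (algTensorEquiv ℂ (Xi M ξ))

/-- The identification of the operators with domain `ℂ ⊗ Ξ` with the operators with domain `Ξ`:
`X ↦ (η ↦ X (1 ⊗ η))`. -/
def unitIdent (F : Type*) [NormedAddCommGroup F] [InnerProductSpace ℂ F] :
    (algTensor ℂ (Xi M ξ) →ₗ[ℂ] HT F H) ≃ₗ[ℂ] (Xi M ξ →ₗ[ℂ] HT F H) :=
  LinearEquiv.arrowCongr (unitEquiv M ξ).symm (LinearEquiv.refl ℂ (HT F H))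

theorem unitIdent_apply (F : Type*) [NormedAddCommGroup F] [InnerProductSpace ℂ F]
    (X : algTensor ℂ (Xi M ξ) →ₗ[ℂ] HT F H) (η : Xi M ξ) :
    unitIdent M ξ F X η = X ⟨tmul 1 (η : H), tmul_mem_algTensor _ 1 η.2⟩ := rfl

/-- `E_ξ = I ⊗ |ξ⟩`, as a map into the linear tensor product of `E` and `Ξ`. -/
def Evec (E : Type*) [NormedAddCommGroup E] [InnerProductSpace ℂ E] :
    E →ₗ[ℂ] algTensor E (Xi M ξ) where
  toFun c := ⟨tmul c ξ, tmul_mem_algTensor _ c (vector_mem_Xi M ξ)⟩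
  map_add' c d := Subtype.ext (add_tmul c d ξ)
  map_smul' a c := Subtype.ext (smul_tmul a c ξ)

/-- `T ↦ T E_ξ`. -/
def compEvec (E : Type*) [NormedAddCommGroup E] [InnerProductSpace ℂ E]
    (F : Type*) [NormedAddCommGroup F] [InnerProductSpace ℂ F] :
    (algTensor E (Xi M ξ) →ₗ[ℂ] HT F H) →ₗ[ℂ] (E →ₗ[ℂ] HT F H) :=
  LinearMap.lcomp ℂ (HT F H) (Evec M ξ E)

/-- The matrix space: the `T ∈ Op_M(E ⊗ Ξ; F ⊗ H)` for which `T E_ξ` is Hilbert-Schmidt. -/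
def Mat (E : Type u) [NormedAddCommGroup E] [InnerProductSpace ℂ E]
    (F : Type w) [NormedAddCommGroup F] [InnerProductSpace ℂ F] :
    Submodule ℂ (algTensor E (Xi M ξ) →ₗ[ℂ] HT F H) :=
  OpM M ξ E F ⊓ (HS E (HT F H)).comap (compEvec M ξ E F)

/-- The adjointable matrix space: the `T` in the matrix space which are in
`Op‡(E ⊗ Ξ, F ⊗ Ξ)` and for which `T†` is also in the matrix space. -/
def MatDag (E : Type u) [NormedAddCommGroup E] [InnerProductSpace ℂ E]
    (F : Type w) [NormedAddCommGroup F] [InnerProductSpace ℂ F] :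
    Submodule ℂ (algTensor E (Xi M ξ) →ₗ[ℂ] HT F H) where
  carrier := {T | T ∈ Mat M ξ E F ∧
    ∃ h : T ∈ OpDag (algTensor E (Xi M ξ)) (algTensor F (Xi M ξ)),
      dagger ⟨T, h⟩ ∈ Mat M ξ F E}
  zero_mem' := ⟨zero_mem _, zero_mem _, dagger_mem_zero _⟩
  add_mem' := fun ⟨hS, hS', hS''⟩ ⟨hT, hT', hT''⟩ =>
    ⟨add_mem hS hT, add_mem hS' hT', dagger_mem_add _ hS' hT' hS'' hT''⟩
  smul_mem' := fun a _ ⟨hT, hT', hT''⟩ =>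
    ⟨Submodule.smul_mem _ a hT, Submodule.smul_mem _ a hT', dagger_mem_smul _ a hT' hT''⟩

/-- `T† = T*|_{F ⊗ Ξ}`, for `T` in the adjointable matrix space. -/
def matDagger {E : Type u} [NormedAddCommGroup E] [InnerProductSpace ℂ E]
    {F : Type w} [NormedAddCommGroup F] [InnerProductSpace ℂ F] (T : MatDag M ξ E F) :
    Mat M ξ F E :=
  ⟨dagger ⟨(T : algTensor E (Xi M ξ) →ₗ[ℂ] HT F H), T.2.2.fst⟩, T.2.2.snd⟩

/-- The column space. -/
abbrev Col (F : Type w) [NormedAddCommGroup F] [InnerProductSpace ℂ F] := Mat M ξ ℂ F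

/-- The adjointable column space. -/
abbrev ColDag (F : Type w) [NormedAddCommGroup F] [InnerProductSpace ℂ F] := MatDag M ξ ℂ F

/-- The row space. -/
abbrev Row (E : Type u) [NormedAddCommGroup E] [InnerProductSpace ℂ E] := Mat M ξ E ℂ

variable [IsCyclicSeparating M ξ]

/-- `B^ξ`, for an operator `B : E → F ⊗ H`: the operator with domain the linear tensor product of
`E` and `Ξ` given by `c ⊗ x' ξ ↦ (I ⊗ x') B c` (`x' ∈ M'`). It satisfies `B^ξ E_ξ = B`. -/
def supXi (B : E →ₗ[ℂ] HT F H) : algTensor E (Xi M ξ) →ₗ[ℂ] HT F H :=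
  TensorProduct.lift
      (LinearMap.mk₂ ℂ (fun (c : E) (η : Xi M ξ) => 
          ampl F ((XiEquiv M ξ).symm η : H →L[ℂ] H) (B c))
        (fun c d η => by rw [map_add, map_add])
        (fun a c η => by rw [map_smul, map_smul])
        (fun c η ζ => by
          rw [map_add, Submodule.coe_add, ampl, htMap_add_right]; rfl)
        (fun a c η => by
          rw [map_smul, Submodule.coe_smul, ampl, htMap_smul_right]; rfl)) ∘ₗ
    (algTensorEquiv E (Xi M ξ)).symm.toLinearMap

theorem supXi_apply (B : E →ₗ[ℂ] HT F H) (c : E) {x : H →L[ℂ] H} (hx : x ∈ M.commutant) :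
    supXi M ξ B ⟨tmul c (x ξ), tmul_mem_algTensor _ c (mem_orbit.2 ⟨x, hx, rfl⟩)⟩ =
      ampl F x (B c) := by
  have h1 : (algTensorEquiv E (Xi M ξ)).symm
      ⟨tmul c (x ξ), tmul_mem_algTensor _ c (mem_orbit.2 ⟨x, hx, rfl⟩)⟩ =
      c ⊗ₜ XiEquiv M ξ ⟨x, hx⟩ := by
    rw [LinearEquiv.symm_apply_eq]
    rfl
  rw [supXi, LinearMap.comp_apply, LinearEquiv.coe_coe, h1, TensorProduct.lift.tmul,
    LinearMap.mk₂_apply, LinearEquiv.symm_apply_apply]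

/-- The matrix transpose `T^⊤ = ((T E_ξ)_⊤)^ξ`. -/
def matTranspose {E : Type u} [NormedAddCommGroup E] [InnerProductSpace ℂ E] [CompleteSpace E]
    {F : Type w} [NormedAddCommGroup F] [InnerProductSpace ℂ F]
    (k₁ : Conjugation E) (k₂ : Conjugation F) (T : Mat M ξ E F) :
    algTensor F (Xi M ξ) →ₗ[ℂ] HT E H :=
  supXi M ξ (hsTranspose k₁ k₂ ⟨compEvec M ξ E F T, T.2.2⟩)

/-- The conjugate `T^{†⊤}` of an adjointable matrix `T`. -/
def matConj {E : Type u} [NormedAddCommGroup E] [InnerProductSpace ℂ E]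
    {F : Type w} [NormedAddCommGroup F] [InnerProductSpace ℂ F] [CompleteSpace F]
    (k₁ : Conjugation E) (k₂ : Conjugation F) (T : MatDag M ξ E F) :
    algTensor E (Xi M ξ) →ₗ[ℂ] HT F H :=
  matTranspose M ξ k₂ k₁ (matDagger M ξ T)

end Affiliated

/-! ### Off-diagonal block matrices and their columns -/

section Blocks

variable {H : Type v} [NormedAddCommGroup H] [InnerProductSpace ℂ H] [CompleteSpace H]
  {K : Type u} [NormedAddCommGroup K] [InnerProductSpace ℂ K]

/-- `k̂ = ℂ ⊕ k`. -/
abbrev Hat (K : Type u) [NormedAddCommGroup K] [InnerProductSpace ℂ K] : Type u := HSum ℂ K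

/-- `A ⊗ I_H`. -/
abbrev ampI {E : Type*} [NormedAddCommGroup E] [InnerProductSpace ℂ E]
    {F : Type*} [NormedAddCommGroup F] [InnerProductSpace ℂ F] (H : Type*)
    [NormedAddCommGroup H] [InnerProductSpace ℂ H] (A : E →L[ℂ] F) : HT E H →ₗ[ℂ] HT F H :=
  (htMap A (ContinuousLinearMap.id ℂ H)).toLinearMap

variable (M : VonNeumannAlgebra H) (ξ : H)

/-- The block matrix `[[0, R], [C, 0]]`, an operator from `k̂ ⊗ H` to `k̂ ⊗ H` with domain the
linear tensor product of `k̂` and `Ξ`. -/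
def offDiag (C : algTensor ℂ (Xi M ξ) →ₗ[ℂ] HT K H) (R : algTensor K (Xi M ξ) →ₗ[ℂ] HT ℂ H) :
    algTensor (Hat K) (Xi M ξ) →ₗ[ℂ] HT (Hat K) H :=
  ampI H (inL ℂ K) ∘ₗ R ∘ₗ algAmp (prR ℂ K) (Xi M ξ) +
    ampI H (inR ℂ K) ∘ₗ C ∘ₗ algAmp (prL ℂ K) (Xi M ξ)

/-- The column `[C; D]`, an operator into `(k ⊕ k) ⊗ H = (k ⊗ H) ⊕ (k ⊗ H)`. -/
def stack (C D : algTensor ℂ (Xi M ξ) →ₗ[ℂ] HT K H) :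
    algTensor ℂ (Xi M ξ) →ₗ[ℂ] HT (HSum K K) H :=
  ampI H (inL K K) ∘ₗ C + ampI H (inR K K) ∘ₗ D

theorem offDiag_add (C C' : algTensor ℂ (Xi M ξ) →ₗ[ℂ] HT K H)
    (R R' : algTensor K (Xi M ξ) →ₗ[ℂ] HT ℂ H) :
    offDiag M ξ (C + C') (R + R') = offDiag M ξ C R + offDiag M ξ C' R' := by
  simp only [offDiag, LinearMap.add_comp, LinearMap.comp_add]
  abel

theorem offDiag_smul (a : ℂ) (C : algTensor ℂ (Xi M ξ) →ₗ[ℂ] HT K H)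
    (R : algTensor K (Xi M ξ) →ₗ[ℂ] HT ℂ H) :
    offDiag M ξ (a • C) (a • R) = a • offDiag M ξ C R := by
  simp only [offDiag, LinearMap.smul_comp, LinearMap.comp_smul, smul_add]

/-- The space of the off-diagonal block matrices `[[0, R], [C, 0]]`, where `C` is in the column
space and `R` is in the row space. -/
def MatZero (K : Type u) [NormedAddCommGroup K] [InnerProductSpace ℂ K] :
    Submodule ℂ (algTensor (Hat K) (Xi M ξ) →ₗ[ℂ] HT (Hat K) H) where
  carrier := {T | ∃ C ∈ Col M ξ K, ∃ R ∈ Row M ξ K, T = offDiag M ξ C R}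
  zero_mem' := ⟨0, zero_mem _, 0, zero_mem _, by simp [offDiag]⟩
  add_mem' := by
    rintro _ _ ⟨C, hC, R, hR, rfl⟩ ⟨C', hC', R', hR', rfl⟩
    exact ⟨C + C', add_mem hC hC', R + R', add_mem hR hR', (offDiag_add M ξ C C' R R').symm⟩
  smul_mem' := by
    rintro a _ ⟨C, hC, R, hR, rfl⟩
    exact ⟨a • C, Submodule.smul_mem _ a hC, a • R, Submodule.smul_mem _ a hR,
      (offDiag_smul M ξ a C R).symm⟩

/-- The off-diagonal block matrices that are adjointable matrices. -/
def MatZeroDag (K : Type u) [NormedAddCommGroup K] [InnerProductSpace ℂ K] :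
    Submodule ℂ (algTensor (Hat K) (Xi M ξ) →ₗ[ℂ] HT (Hat K) H) :=
  MatZero M ξ K ⊓ MatDag M ξ (Hat K) (Hat K)

theorem offDiag_mem {C : algTensor ℂ (Xi M ξ) →ₗ[ℂ] HT K H} (hC : C ∈ Col M ξ K)
    {R : algTensor K (Xi M ξ) →ₗ[ℂ] HT ℂ H} (hR : R ∈ Row M ξ K) :
    offDiag M ξ C R ∈ MatZero M ξ K :=
  ⟨C, hC, R, hR, rfl⟩

/-- The vector `1 ⊗ ξ` of the domain `ℂ ⊗ Ξ`, identified with `ξ`. -/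
def unitVec : algTensor ℂ (Xi M ξ) := unitEquiv M ξ ⟨ξ, vector_mem_Xi M ξ⟩

end Blocks

end AffMat

end

open AffMat

noncomputable section

namespace AffMat

universe u v w

/-! ### Coordinate maps of a direct sum, as adjoint pairs -/

section DirectSum

variable {E : Type*} [NormedAddCommGroup E] [InnerProductSpace ℂ E]
  {F : Type*} [NormedAddCommGroup F] [InnerProductSpace ℂ F]

/-! An operator affiliated to `M` intertwines all of `M'`, because `M'` is spanned by its unitaries.
So `T (c ⊗ x'ξ) = (I ⊗ x') T (c ⊗ ξ)`, and `T` is determined by `T E_ξ` (`OpM_ext`). On `ℂ` every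
linear map is Hilbert-Schmidt, which identifies the column space with `Op_M`. Partial transposition
exchanges the slices of `B`, that is, `(⟨c| ⊗ I) B_⊤ d = (⟨d̄| ⊗ I) B c̄`. Hence it preserves the
Hilbert-Schmidt norm and is an involution, rows correspond linearly to columns
(`matTransposeEquiv`), and the column map is a composite of isomorphisms.

Adjoints are handled through formal adjoints: as `E ⊙ Ξ` is dense, `T` is adjointable as soon as it
has a formal adjoint in the opposite matrix space, and that operator is then `T†`. The central
identity is that `T^⊤` is formally adjoint to `T̄ = (T†)^⊤` (`formalDagger_matConj`). It shows that
transposition preserves adjointability and that the conjugate of `T^⊤` is `T†`. For `T` with entries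
`C`, `R`, the matrix `T†` has lower left entry `R†` and upper right entry `C†`, while `T̄` has `C̄`
and `R̄`. Therefore `col T† = [R†; C̄]` and `col T̄ = [C̄; R†]`, which is also the conjugate of `[C;
R^⊤]`.

For the domain statement, put `X = col T` and slice `Xξ` by `⟨e| ⊗ I` and `X̄ξ` by `⟨ē| ⊗ I`. Formal
adjointness of `X` and `X†` says that the resulting pair `(η, ζ)` satisfies `⟪x'η, y'ξ⟫ = ⟪x'ξ,
y'ζ⟫` on `M'`. By Tomita-Takesaki theory such a pair lies in the graph of `S_ξ`. This is proved in
`exists_mem_approx`, where elements of `M` are read off as corners of projections onto graphs.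
Summing over an orthonormal basis places `(Xξ, πX̄ξ)` in the closed graph of `k^π ⊗ S_ξ`. -/

@[simp] theorem prL_inL (x : E) : prL E F (inL E F x) = x := rfl
@[simp] theorem prR_inR (y : F) : prR E F (inR E F y) = y := rfl
@[simp] theorem prL_inR (y : F) : prL E F (inR E F y) = 0 := rfl
@[simp] theorem prR_inL (x : E) : prR E F (inL E F x) = 0 := rfl

theorem inL_prL_add_inR_prR (z : HSum E F) :
    inL E F (prL E F z) + inR E F (prR E F z) = z := by
  apply WithLp.ofLp_injective 2
  apply Prod.ext
  · exact add_zero _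
  · exact zero_add _

theorem inner_inL (x : E) (z : HSum E F) : ⟪inL E F x, z⟫_ℂ = ⟪x, prL E F z⟫_ℂ := by
  rw [WithLp.prod_inner_apply]
  change ⟪x, prL E F z⟫_ℂ + ⟪(0 : F), prR E F z⟫_ℂ = _
  rw [inner_zero_left, add_zero]

theorem inner_inR (y : F) (z : HSum E F) : ⟪inR E F y, z⟫_ℂ = ⟪y, prR E F z⟫_ℂ := by
  rw [WithLp.prod_inner_apply]
  change ⟪(0 : E), prL E F z⟫_ℂ + ⟪y, prR E F z⟫_ℂ = _
  rw [inner_zero_left, zero_add]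

theorem inner_prL (z : HSum E F) (x : E) : ⟪prL E F z, x⟫_ℂ = ⟪z, inL E F x⟫_ℂ := by
  rw [← inner_conj_symm, ← inner_inL, inner_conj_symm]

theorem inner_prR (z : HSum E F) (y : F) : ⟪prR E F z, y⟫_ℂ = ⟪z, inR E F y⟫_ℂ := by
  rw [← inner_conj_symm, ← inner_inR, inner_conj_symm]

theorem norm_inL (x : E) : ‖inL E F x‖ = ‖x‖ := by
  rw [@norm_eq_sqrt_re_inner ℂ, @norm_eq_sqrt_re_inner ℂ _ _ _ _ x, inner_inL, prL_inL]

theorem norm_inR (y : F) : ‖inR E F y‖ = ‖y‖ := by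
  rw [@norm_eq_sqrt_re_inner ℂ, @norm_eq_sqrt_re_inner ℂ _ _ _ _ y, inner_inR, prR_inR]

theorem norm_prL_le (z : HSum E F) : ‖prL E F z‖ ≤ ‖z‖ := WithLp.norm_fst_le ..

theorem norm_prR_le (z : HSum E F) : ‖prR E F z‖ ≤ ‖z‖ := WithLp.norm_snd_le ..

end DirectSum

/-! ### Graph projections and the closure of `xξ ↦ x*ξ` -/

section VonNeumann

variable {H : Type v} [NormedAddCommGroup H] [InnerProductSpace ℂ H] [CompleteSpace H]

/-- A von Neumann algebra is spanned by its unitaries. -/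
theorem vonNeumann_induction_unitary (N : VonNeumannAlgebra H) {p : (H →L[ℂ] H) → Prop}
    (unit : ∀ u ∈ N, u ∈ unitary (H →L[ℂ] H) → p u) (zero : p 0)
    (add : ∀ x y, p x → p y → p (x + y)) (smul : ∀ (a : ℂ) x, p x → p (a • x))
    {x : H →L[ℂ] H} (hx : x ∈ N) : p x := by
  -- A double commutant is norm closed, so `N` is a C*-algebra and its elements are combinations of
  -- four unitaries.
  have hcl : IsClosed (N.toStarSubalgebra : Set (H →L[ℂ] H)) := by
    have h : (N : Set (H →L[ℂ] H)) = Set.centralizer (Set.centralizer (N : Set (H →L[ℂ] H))) :=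
      N.centralizer_centralizer.symm
    rw [VonNeumannAlgebra.coe_toStarSubalgebra, h]
    exact Set.isClosed_centralizer _
  obtain ⟨u, c, h, -⟩ :=
    CStarAlgebra.exists_sum_four_unitary (⟨x, hx⟩ : N.toStarSubalgebra)
  have h' : x = ∑ i, c i • ((u i : N.toStarSubalgebra) : H →L[ℂ] H) := by
    have := congrArg (fun y : N.toStarSubalgebra => (y : H →L[ℂ] H)) h
    simpa using this
  rw [h']
  refine Finset.sum_induction _ p add zero fun i _ =>
    smul _ _ (unit _ (u i : N.toStarSubalgebra).2 ?_)
  have h1 := Unitary.mem_iff.1 (u i).2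
  exact Unitary.mem_iff.2 ⟨congrArg Subtype.val h1.1, congrArg Subtype.val h1.2⟩

theorem mem_of_commute_commutant {M : VonNeumannAlgebra H} {a : H →L[ℂ] H}
    (h : ∀ x ∈ M.commutant, ∀ v, a (x v) = x (a v)) : a ∈ M := by
  rw [← M.commutant_commutant, VonNeumannAlgebra.mem_commutant_iff]
  intro x hx
  ext v
  exact (h x hx v).symm

/-- An orthogonal projection onto a subspace which reduces `x` commutes with `x`. -/
theorem starProjection_comm {X : Type*} [NormedAddCommGroup X] [InnerProductSpace ℂ X]
    (G : Submodule ℂ X) [G.HasOrthogonalProjection] (A B : X →L[ℂ] X)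
    (hAB : ∀ v w, ⟪A v, w⟫_ℂ = ⟪v, B w⟫_ℂ) (hA : ∀ v ∈ G, A v ∈ G) (hB : ∀ v ∈ G, B v ∈ G)
    (v : X) : G.starProjection (A v) = A (G.starProjection v) := by
  refine Submodule.eq_starProjection_of_mem_of_inner_eq_zero
    (hA _ (G.starProjection_apply_mem v)) fun w hw => ?_
  rw [← map_sub, hAB]
  exact Submodule.starProjection_inner_eq_zero v _ (hB w hw)

variable (M : VonNeumannAlgebra H) (ξ : H) [hξ : IsCyclicSeparating M ξ]

/-- A separating vector for `M` is cyclic for `M'`. -/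
theorem dense_Xi : Dense (Xi M ξ : Set H) := by
  set G := (Xi M ξ).topologicalClosure with hG
  have hinv : ∀ x ∈ M.commutant, ∀ v ∈ G, x v ∈ G := fun x hx v hv =>
    map_mem_closure x.continuous hv fun w hw => apply_mem_Xi M ξ hx hw
  -- The closure of `M'ξ` reduces `M'`, so the projection onto its complement lies in `M''= M`. It
  -- kills `ξ`, and `ξ` separates `M`.
  have hP : (1 - G.starProjection : H →L[ℂ] H) ∈ M := by
    refine mem_of_commute_commutant fun x hx v => ?_
    have h := starProjection_comm G x (star x)
      (fun v w => (ContinuousLinearMap.adjoint_inner_right x v w).symm)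
      (hinv x hx) (hinv _ (star_mem hx)) v
    change x v - G.starProjection (x v) = x (v - G.starProjection v)
    rw [h, map_sub]
  have h1 : (1 - G.starProjection : H →L[ℂ] H) ξ = 0 := by
    change ξ - G.starProjection ξ = 0
    rw [sub_eq_zero, eq_comm, Submodule.starProjection_eq_self_iff]
    exact subset_closure (vector_mem_Xi M ξ)
  have h2 := hξ.separating _ hP h1
  intro v
  have h3 : v - G.starProjection v = 0 := congrArg (fun A : H →L[ℂ] H => A v) h2
  rw [sub_eq_zero, eq_comm, Submodule.starProjection_eq_self_iff] at h3
  exact h3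

/-- If the operator `x' ξ ↦ x' η` has a formal adjoint `x' ξ ↦ x' ζ`, then there are `x ∈ M` such
that `x ξ` is close to `η` and `x* ξ` is close to `ζ`. The proof uses the orthogonal projections
onto the closed graphs of the multiples `x' ξ ↦ t x' η`. -/
theorem exists_mem_approx {η ζ : H}
    (h : ∀ x ∈ M.commutant, ∀ y ∈ M.commutant, ⟪x η, y ξ⟫_ℂ = ⟪x ξ, y ζ⟫_ℂ)
    {ε : ℝ} (hε : 0 < ε) :
    ∃ x ∈ M, ‖x ξ - η‖ < ε ∧ ‖(star x) ξ - ζ‖ < ε := by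
  have hnear : ∀ v : H, ∃ x ∈ M.commutant, ‖v - x ξ‖ < ε / 2 := by
    intro v
    obtain ⟨y, hy, hd⟩ := (dense_Xi M ξ).exists_dist_lt v (half_pos hε)
    obtain ⟨x, hx, rfl⟩ := mem_orbit.1 hy
    exact ⟨x, hx, by rwa [dist_eq_norm] at hd⟩
  obtain ⟨a, ha, haη⟩ := hnear η
  obtain ⟨b, hb, hbζ⟩ := hnear ζ
  -- `t` is chosen after `a` and `b`: the two errors below are at most `‖η - aξ‖ + t‖aζ‖` and `‖ζ -
  -- bξ‖ + t‖bη‖`.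
  obtain ⟨t, ht, hta, htb⟩ : ∃ t : ℝ, 0 < t ∧ t * ‖a ζ‖ < ε / 2 ∧ t * ‖b η‖ < ε / 2 := by
    refine ⟨ε / 2 / (‖a ζ‖ + ‖b η‖ + 1), by positivity, ?_, ?_⟩
    · rw [div_mul_eq_mul_div, div_lt_iff₀ (by positivity)]
      have := norm_nonneg (b η)
      nlinarith
    · rw [div_mul_eq_mul_div, div_lt_iff₀ (by positivity)]
      have := norm_nonneg (a ζ)
      nlinarith
  have ht0 : (t : ℂ) ≠ 0 := by exact_mod_cast ht.ne'
  let g : vnSub M.commutant →ₗ[ℂ] HSum H H :=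
    (inL H H).toLinearMap ∘ₗ vnEval M.commutant ξ +
      (t : ℂ) • ((inR H H).toLinearMap ∘ₗ vnEval M.commutant η)
  have hg : ∀ x : vnSub M.commutant, g x = inL H H ((x : H →L[ℂ] H) ξ) +
    (t : ℂ) • inR H H ((x : H →L[ℂ] H) η) := fun x => rfl
  set G := (LinearMap.range g).topologicalClosure with hG
  have hmem : ∀ x ∈ M.commutant, inL H H (x ξ) + (t : ℂ) • inR H H (x η) ∈ G :=
    fun x hx => subset_closure ⟨⟨x, hx⟩, rfl⟩
  -- The complement of a graph contains the rotated graph of any formal adjoint; this is where `h`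
  -- enters.
  have horth : ∀ x ∈ M.commutant, inR H H (x ξ) - (t : ℂ) • inL H H (x ζ) ∈ Gᗮ := by
    intro x hx
    rw [hG, Submodule.orthogonal_closure]
    rintro _ ⟨y, rfl⟩
    rw [hg, inner_add_left, inner_smul_left, inner_inL, inner_inR]
    simp only [map_sub, map_smul, prL_inR, prL_inL, prR_inR, prR_inL, Complex.conj_ofReal]
    rw [zero_sub, smul_zero, sub_zero, inner_neg_right, inner_smul_right, h y y.2 x hx]
    ring
  set P := G.starProjection with hP
  -- The diagonal action of `M'` on `H ⊕ H` leaves `G` invariant, so it commutes with `P`, and each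
  -- corner of `P` lies in `M`.
  let Δ : (H →L[ℂ] H) → (HSum H H →L[ℂ] HSum H H) := fun x =>
    inL H H ∘L x ∘L prL H H + inR H H ∘L x ∘L prR H H
  have hΔ : ∀ x z, Δ x z = inL H H (x (prL H H z)) + inR H H (x (prR H H z)) := fun _ _ => rfl
  have hinv : ∀ x ∈ M.commutant, ∀ z ∈ G, Δ x z ∈ G := by
    intro x hx z hz
    refine map_mem_closure (Δ x).continuous hz ?_
    rintro _ ⟨y, rfl⟩
    refine ⟨⟨x * (y : H →L[ℂ] H), M.commutant.mul_mem' hx y.2⟩, ?_⟩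
    rw [hΔ, hg, hg]
    simp only [map_add, map_smul, prL_inR, prL_inL, prR_inR, prR_inL]
    simp
  have hcomm : ∀ x ∈ M.commutant, ∀ z, P (Δ x z) = Δ x (P z) := by
    intro x hx
    refine starProjection_comm G (Δ x) (Δ (star x)) (fun z w => ?_) (hinv x hx)
      (hinv _ (star_mem hx))
    rw [hΔ, hΔ, inner_add_left, inner_add_right, inner_inL, inner_inR, ← inner_prL, ← inner_prR]
    exact congrArg₂ _ (ContinuousLinearMap.adjoint_inner_right x _ _).symm
      (ContinuousLinearMap.adjoint_inner_right x _ _).symm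
  -- If `A` is the closure of `x'ξ ↦ x'η`, the lower left corner of `P` is `tA(1 + t²A*A)⁻¹`. After
  -- division by `t` it approximates `A` for small `t`.
  let c : H →L[ℂ] H := (t : ℂ)⁻¹ • (prR H H ∘L P ∘L inL H H)
  have hc : ∀ v, c v = (t : ℂ)⁻¹ • prR H H (P (inL H H v)) := fun _ => rfl
  have hcs : ∀ v, (star c) v = (t : ℂ)⁻¹ • prL H H (P (inR H H v)) := by
    intro v
    refine ext_inner_right ℂ fun w => ?_
    rw [ContinuousLinearMap.star_eq_adjoint, ContinuousLinearMap.adjoint_inner_left, hc,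
      inner_smul_left, inner_smul_right, inner_prL, ← inner_inR, hP,
      Submodule.inner_starProjection_left_eq_right]
    simp
  refine ⟨c, mem_of_commute_commutant fun x hx v => ?_, ?_, ?_⟩
  · have h1 := hcomm x hx (inL H H v)
    have h2 : Δ x (inL H H v) = inL H H (x v) := by rw [hΔ]; simp
    rw [h2] at h1
    rw [hc, hc, h1, hΔ]
    simp
  · have h1 : P (inL H H ξ) = inL H H ξ + (t : ℂ) • inR H H η - (t : ℂ) • P (inR H H η) := by
      have h2 := Submodule.starProjection_eq_self_iff.2 (hmem 1 (one_mem _))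
      rw [eq_sub_iff_add_eq, ← map_smul, ← map_add]
      exact h2
    -- Since `P` fixes `ξ ⊕ tη`, the error is a corner of `P` applied to `η`. It is small because
    -- `P(0 ⊕ aξ) = tP(aζ ⊕ 0)` and `aξ` is near `η`.
    have h3 : c ξ - η = - prR H H (P (inR H H η)) := by
      rw [hc, h1]
      simp only [map_sub, map_add, map_smul, prR_inL, prR_inR, zero_add]
      rw [← smul_sub, inv_smul_smul₀ ht0, sub_sub_cancel_left]
    have h4 : P (inR H H (a ξ)) = (t : ℂ) • P (inL H H (a ζ)) := by
      have h2 := (Submodule.starProjection_apply_eq_zero_iff _).2 (horth a ha)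
      rwa [map_sub, sub_eq_zero, map_smul] at h2
    have h5 : P (inR H H η) = P (inR H H (η - a ξ)) + (t : ℂ) • P (inL H H (a ζ)) := by
      rw [← h4, map_sub, map_sub, sub_add_cancel]
    rw [h3, norm_neg]
    calc ‖prR H H (P (inR H H η))‖ ≤ ‖P (inR H H η)‖ := norm_prR_le _
      _ ≤ ‖P (inR H H (η - a ξ))‖ + ‖(t : ℂ) • P (inL H H (a ζ))‖ := by
        rw [h5]; exact norm_add_le _ _
      _ ≤ ‖η - a ξ‖ + t * ‖a ζ‖ := by
        rw [norm_smul, Complex.norm_real, Real.norm_of_nonneg ht.le]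
        gcongr
        · exact (G.norm_starProjection_apply_le _).trans (norm_inR _).le
        · exact (G.norm_starProjection_apply_le _).trans (norm_inL _).le
      _ < ε := by linarith
  · have h1 : P (inR H H ξ) = (t : ℂ) • P (inL H H ζ) := by
      have h2 := (Submodule.starProjection_apply_eq_zero_iff _).2 (horth 1 (one_mem _))
      rwa [map_sub, sub_eq_zero, map_smul] at h2
    have hQ : ∀ z, ‖z - P z‖ ≤ ‖z‖ := by
      intro z
      have h2 : z - P z = Gᗮ.starProjection z := (G.starProjection_orthogonal_val z).symm
      rw [h2]
      exact Gᗮ.norm_starProjection_apply_le z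
    -- The dual estimate has `1 - P` in place of `P`: `1 - P` sends `bξ ⊕ 0` to `-t` times its value
    -- at `0 ⊕ bη`, and `bξ` is near `ζ`.
    have h3 : (star c) ξ - ζ = - prL H H (inL H H ζ - P (inL H H ζ)) := by
      rw [hcs, h1, map_smul, inv_smul_smul₀ ht0, map_sub, prL_inL, neg_sub]
    have h4 : inL H H (b ξ) - P (inL H H (b ξ)) =
        -((t : ℂ) • (inR H H (b η) - P (inR H H (b η)))) := by
      have h2 := Submodule.starProjection_eq_self_iff.2 (hmem b hb)
      rw [map_add, map_smul] at h2
      rw [smul_sub, neg_sub, sub_eq_sub_iff_add_eq_add, ← hP] at *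
      rw [← h2]
      abel
    have h5 : inL H H ζ - P (inL H H ζ) = (inL H H (ζ - b ξ) - P (inL H H (ζ - b ξ))) +
        -((t : ℂ) • (inR H H (b η) - P (inR H H (b η)))) := by
      rw [← h4, map_sub, map_sub]
      abel
    rw [h3, norm_neg]
    calc ‖prL H H (inL H H ζ - P (inL H H ζ))‖ ≤ ‖inL H H ζ - P (inL H H ζ)‖ := norm_prL_le _
      _ ≤ ‖inL H H (ζ - b ξ) - P (inL H H (ζ - b ξ))‖ +
          ‖-((t : ℂ) • (inR H H (b η) - P (inR H H (b η))))‖ := by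
        rw [h5]; exact norm_add_le _ _
      _ ≤ ‖ζ - b ξ‖ + t * ‖b η‖ := by
        rw [norm_neg, norm_smul, Complex.norm_real, Real.norm_of_nonneg ht.le]
        gcongr
        · exact (hQ _).trans (norm_inL _).le
        · exact (hQ _).trans (norm_inR _).le
      _ < ε := by linarith

/-- The hypothesis says that `ζ` is the value at `η` of the adjoint of `y'ξ ↦ y'*ξ` (`y' ∈ M'`). So
this is the hard inclusion in the description of `S_ξ` as that adjoint. -/
theorem mem_closure_graph_tomitaPre {η ζ : H}
    (h : ∀ x ∈ M.commutant, ∀ y ∈ M.commutant, ⟪x η, y ξ⟫_ℂ = ⟪x ξ, y ζ⟫_ℂ) :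
    (η, ζ) ∈ closure (conjGraph (tomitaPre M ξ)) := by
  rw [Metric.mem_closure_iff]
  intro ε hε
  obtain ⟨x, hx, h1, h2⟩ := exists_mem_approx M ξ h hε
  refine ⟨(x ξ, star x ξ), ⟨mem_orbit.2 ⟨x, hx, rfl⟩, tomitaPre_apply M ξ hx⟩, ?_⟩
  rw [dist_comm, Prod.dist_eq, dist_eq_norm, dist_eq_norm]
  exact max_lt h1 h2

/-- Pairs in the closure of the graph of `x ξ ↦ x* ξ` are formally adjoint on `M' ξ`. -/
theorem inner_of_mem_closure_graph_tomitaPre {η ζ : H}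
    (h : (η, ζ) ∈ closure (conjGraph (tomitaPre M ξ))) {x : H →L[ℂ] H} (hx : x ∈ M.commutant) :
    ⟪x ξ, ζ⟫_ℂ = ⟪η, (star x) ξ⟫_ℂ := by
  have hcl : IsClosed {p : H × H | ⟪x ξ, p.2⟫_ℂ = ⟪p.1, (star x) ξ⟫_ℂ} :=
    isClosed_eq (by fun_prop) (by fun_prop)
  refine closure_minimal ?_ hcl h
  rintro ⟨_, ζ'⟩ ⟨h1, h2⟩
  obtain ⟨y, hy, rfl⟩ := mem_orbit.1 h1
  rw [tomitaPre_apply M ξ hy] at h2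
  subst h2
  change ⟪x ξ, (star y) ξ⟫_ℂ = ⟪y ξ, (star x) ξ⟫_ℂ
  rw [ContinuousLinearMap.star_eq_adjoint, ContinuousLinearMap.star_eq_adjoint,
    ContinuousLinearMap.adjoint_inner_right, ContinuousLinearMap.adjoint_inner_right]
  have h3 := VonNeumannAlgebra.mem_commutant_iff.1 hx y hy
  have h4 : y (x ξ) = x (y ξ) := congrArg (fun z => z ξ) h3
  rw [h4]

end VonNeumann

/-! ### Closability and the graph of the Tomita operator -/

section Closure

variable {X : Type*} [NormedAddCommGroup X] [InnerProductSpace ℂ X]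
  {Y : Type*} [NormedAddCommGroup Y] [InnerProductSpace ℂ Y]

/-- `conjClosure` returns the operator itself when it is not closable, so closability must be
supplied before its graph is the closed graph. -/
theorem mem_conjGraph_conjClosure {A : X →ₛₗ.[starRingEnd ℂ] Y} (hA : ConjClosable A) {x : X}
    {y : Y} : (x, y) ∈ conjGraph (conjClosure A) ↔ (x, y) ∈ closure (conjGraph A) := by
  rw [conjClosure, dif_pos hA]
  constructor
  · rintro ⟨h1, h2⟩
    change Classical.choose h1 = y at h2
    rw [← h2]
    exact Classical.choose_spec h1
  · intro h
    exact ⟨⟨y, h⟩, hA.unique (Classical.choose_spec (⟨y, h⟩ : ∃ y, (x, y) ∈ _)) h⟩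

end Closure

section Tomita

variable {H : Type v} [NormedAddCommGroup H] [InnerProductSpace ℂ H] [CompleteSpace H]
  (M : VonNeumannAlgebra H) (ξ : H) [hξ : IsCyclicSeparating M ξ]

/-- A limit `(0, y)` of points of the graph has `y` orthogonal to `M'ξ`, which is dense. -/
theorem conjClosable_tomitaPre : ConjClosable (tomitaPre M ξ) := by
  intro y hy
  refine (dense_Xi M ξ).eq_zero_of_inner_right ℂ fun v hv => ?_
  obtain ⟨x, hx, rfl⟩ := mem_orbit.1 hv
  rw [inner_of_mem_closure_graph_tomitaPre M ξ hy hx, inner_zero_left]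

theorem mem_graph_tomita {η ζ : H} :
    (η, ζ) ∈ conjGraph (tomita M ξ) ↔ (η, ζ) ∈ closure (conjGraph (tomitaPre M ξ)) :=
  mem_conjGraph_conjClosure (conjClosable_tomitaPre M ξ)

end Tomita

/-! ### Parseval's identity with values in `[0, ∞]` -/

section Parseval

variable {E : Type*} [NormedAddCommGroup E] [InnerProductSpace ℂ E]

/-- Sums in `ENNReal` can be interchanged without summability conditions; the Hilbert-Schmidt
arguments rest on such interchanges. -/
theorem HilbertBasis_tsum_enorm_sq {ι : Type*} (b : HilbertBasis ι ℂ E) (x : E) :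
    ∑' i, ‖⟪b i, x⟫_ℂ‖ₑ ^ 2 = ‖x‖ₑ ^ 2 := by
  have h1 : HasSum (fun i => ‖⟪b i, x⟫_ℂ‖ ^ 2) (‖x‖ ^ 2) := by
    have h2 := (b.hasSum_inner_mul_inner x x).mapL Complex.reCLM
    convert h2 using 1
    · funext i
      rw [← inner_conj_symm x (b i), Complex.conj_mul']
      norm_cast
    · rw [inner_self_eq_norm_sq_to_K]
      norm_cast
  have h2 : HasSum (fun i => ‖⟪b i, x⟫_ℂ‖₊ ^ 2) (‖x‖₊ ^ 2) := by
    rw [← NNReal.hasSum_coe]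
    simpa using h1
  have h3 := (ENNReal.hasSum_coe.2 h2).tsum_eq
  exact_mod_cast h3

theorem HilbertBasis_eq_zero {ι : Type*} (b : HilbertBasis ι ℂ E) {x : E}
    (h : ∀ i, ⟪b i, x⟫_ℂ = 0) : x = 0 := by
  have h1 := HilbertBasis_tsum_enorm_sq b x
  simp_rw [h] at h1
  simpa using h1.symm

theorem summable_norm_sq_iff {E : Type*} [NormedAddCommGroup E] {ι : Type*} (f : ι → E) :
    (Summable fun i => ‖f i‖ ^ 2) ↔ ∑' i, ‖f i‖ₑ ^ 2 ≠ ⊤ := by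
  have h : ∀ i, ‖f i‖ₑ ^ 2 = ((‖f i‖₊ ^ 2 : NNReal) : ENNReal) := fun i => by
    rw [ENNReal.coe_pow]; rfl
  simp_rw [h]
  rw [ENNReal.tsum_coe_ne_top_iff_summable, ← NNReal.summable_coe]
  simp

end Parseval

/-! ### Hilbert-Schmidt operators -/

section HilbertSchmidt

variable {E : Type u} [NormedAddCommGroup E] [InnerProductSpace ℂ E] [CompleteSpace E]
  {X : Type v} [NormedAddCommGroup X] [InnerProductSpace ℂ X] [CompleteSpace X]

/-- Both sides are the double sum of `|⟪g j, B (b i)⟫|²`. As `b` and `g` are independent, either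
basis may be changed by passing to the adjoint and back. -/
theorem tsum_enorm_sq_adjoint {ι κ : Type*} (b : HilbertBasis ι ℂ E) (g : HilbertBasis κ ℂ X)
    (B : E →L[ℂ] X) :
    ∑' i, ‖B (b i)‖ₑ ^ 2 = ∑' j, ‖ContinuousLinearMap.adjoint B (g j)‖ₑ ^ 2 := by
  simp_rw [← HilbertBasis_tsum_enorm_sq g (B _), ← HilbertBasis_tsum_enorm_sq b (_)]
  rw [ENNReal.tsum_comm]
  refine tsum_congr fun j => tsum_congr fun i => ?_
  rw [ContinuousLinearMap.adjoint_inner_right, ← inner_conj_symm, RCLike.enorm_conj]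

/-- The Hilbert-Schmidt property may be checked on one orthonormal basis. -/
theorem mem_HS_of_basis {ι : Type*} (b : HilbertBasis ι ℂ E) (B : E →L[ℂ] X)
    (h : ∑' i, ‖B (b i)‖ₑ ^ 2 ≠ ⊤) : (B : E →ₗ[ℂ] X) ∈ HS E X := by
  refine ⟨B.continuous, fun κ b' => ?_⟩
  rw [summable_norm_sq_iff]
  change ∑' i, ‖B (b' i)‖ₑ ^ 2 ≠ ⊤
  rwa [tsum_enorm_sq_adjoint b' (stdBasis X), ← tsum_enorm_sq_adjoint b (stdBasis X)]

/-- `HS` quantifies only over bases indexed in the universe of `E`; the detour through the adjoint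
removes that restriction. -/
theorem tsum_ne_top_of_mem_HS {B : E →ₗ[ℂ] X} (hB : B ∈ HS E X) {ι : Type*}
    (b : HilbertBasis ι ℂ E) : ∑' i, ‖B (b i)‖ₑ ^ 2 ≠ ⊤ := by
  let B' : E →L[ℂ] X := ⟨B, hB.1⟩
  change ∑' i, ‖B' (b i)‖ₑ ^ 2 ≠ ⊤
  rw [tsum_enorm_sq_adjoint b (stdBasis X), ← tsum_enorm_sq_adjoint (stdBasis E) (stdBasis X)]
  exact (summable_norm_sq_iff _).1 (hB.2 _ (stdBasis E))

theorem tsum_enorm_sq_clm_ne_top {X : Type*} [NormedAddCommGroup X] [NormedSpace ℂ X]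
    {Y : Type*} [NormedAddCommGroup Y] [NormedSpace ℂ Y] (D : X →L[ℂ] Y) {ι : Type*}
    {f : ι → X} (h : ∑' i, ‖f i‖ₑ ^ 2 ≠ ⊤) : ∑' i, ‖D (f i)‖ₑ ^ 2 ≠ ⊤ := by
  have h1 : ∑' i, ‖D (f i)‖ₑ ^ 2 ≤ ∑' i, ‖D‖ₑ ^ 2 * ‖f i‖ₑ ^ 2 :=
    ENNReal.tsum_le_tsum fun i => by
      rw [← mul_pow]
      gcongr
      exact D.le_opENorm _
  rw [ENNReal.tsum_mul_left] at h1
  exact ne_top_of_le_ne_top (ENNReal.mul_ne_top (by finiteness) h) h1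

theorem HS_comp_left {Y : Type*} [NormedAddCommGroup Y] [InnerProductSpace ℂ Y] [CompleteSpace Y]
    {B : E →ₗ[ℂ] X} (hB : B ∈ HS E X) (D : X →L[ℂ] Y) : D.toLinearMap ∘ₗ B ∈ HS E Y :=
  mem_HS_of_basis (stdBasis E) (D ∘L ⟨B, hB.1⟩)
    (tsum_enorm_sq_clm_ne_top D (tsum_ne_top_of_mem_HS hB (stdBasis E)))

theorem HS_comp_right {E' : Type*} [NormedAddCommGroup E'] [InnerProductSpace ℂ E']
    [CompleteSpace E'] {B : E →ₗ[ℂ] X} (hB : B ∈ HS E X) (A : E' →L[ℂ] E) :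
    B ∘ₗ A.toLinearMap ∈ HS E' X := by
  let B' : E →L[ℂ] X := ⟨B, hB.1⟩
  refine mem_HS_of_basis (stdBasis E') (B' ∘L A) ?_
  -- `A` need not map a basis to a basis. On the adjoint side it becomes a bounded operator applied
  -- after `B*`, where the norm bound suffices.
  rw [tsum_enorm_sq_adjoint _ (stdBasis X), ContinuousLinearMap.adjoint_comp]
  refine tsum_enorm_sq_clm_ne_top (ContinuousLinearMap.adjoint A) (f := fun i =>
    ContinuousLinearMap.adjoint B' (stdBasis X i)) ?_
  rw [← tsum_enorm_sq_adjoint (stdBasis E)]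
  exact tsum_ne_top_of_mem_HS hB (stdBasis E)

/-- Every linear operator on `ℂ` is a Hilbert-Schmidt operator. -/
theorem HS_complex (X : Type*) [NormedAddCommGroup X] [InnerProductSpace ℂ X] : HS ℂ X = ⊤ := by
  rw [eq_top_iff]
  refine fun B _ => ⟨LinearMap.continuous_of_finiteDimensional B, fun ι b => ?_⟩
  have : Finite ι := b.orthonormal.linearIndependent.finite
  exact Summable.of_finite

end HilbertSchmidt

/-! ### Slices and bases of the Hilbert space tensor product -/

section Tensor

variable {E : Type*} [NormedAddCommGroup E] [InnerProductSpace ℂ E]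
  {H : Type*} [NormedAddCommGroup H] [InnerProductSpace ℂ H]

theorem eq_zero_of_inner_tmul {z : HT E H} (h : ∀ c v, ⟪tmul c v, z⟫_ℂ = 0) : z = 0 := by
  refine (denseRange_toHT (E := E) (F := H)).eq_zero_of_inner_right ℂ fun t => ?_
  induction t using TensorProduct.induction_on with
  | zero => rw [map_zero, inner_zero_left]
  | tmul c v => exact h c v
  | add x y hx hy => rw [map_add, inner_add_left, hx, hy, add_zero]

theorem ext_inner_tmul {y z : HT E H} (h : ∀ c v, ⟪tmul c v, y⟫_ℂ = ⟪tmul c v, z⟫_ℂ) : y = z := by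
  rw [← sub_eq_zero]
  refine eq_zero_of_inner_tmul fun c v => ?_
  rw [inner_sub_right, h, sub_self]

theorem dense_algTensor {D : Submodule ℂ H} (hD : Dense (D : Set H)) :
    Dense (algTensor E D : Set (HT E H)) := by
  have h1 : ∀ t, toHT E H t ∈ (algTensor E D).topologicalClosure := by
    intro t
    induction t using TensorProduct.induction_on with
    | zero => rw [map_zero]; exact zero_mem _
    | tmul c v =>
      exact map_mem_closure (f := tmulL H c) (tmulL H c).continuous (hD v)
        fun w hw => tmul_mem_algTensor D c hw
    | add x y hx hy => rw [map_add]; exact add_mem hx hy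
  have h2 : Dense (closure (algTensor E D : Set (HT E H))) :=
    (denseRange_toHT (E := E) (F := H)).mono (by rintro _ ⟨t, rfl⟩; exact h1 t)
  exact dense_closure.1 h2

theorem orthonormal_tmul {ι κ : Type*} {e : ι → E} (he : Orthonormal ℂ e) {h : κ → H}
    (hh : Orthonormal ℂ h) : Orthonormal ℂ fun p : ι × κ => tmul (e p.1) (h p.2) := by
  classical
  rw [orthonormal_iff_ite] at *
  rintro ⟨i, m⟩ ⟨j, n⟩
  rw [inner_tmul, he, hh]
  by_cases h1 : i = j <;> by_cases h2 : m = n <;> simp [h1, h2]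

/-- `c ⊗ v` as a bounded operator in `c`. -/
def tmulR (E : Type*) [NormedAddCommGroup E] [InnerProductSpace ℂ E] (v : H) : E →L[ℂ] HT E H :=
  LinearMap.mkContinuous
    { toFun := fun c => tmul c v
      map_add' := fun c d => add_tmul c d v
      map_smul' := fun a c => smul_tmul a c v } ‖v‖
    fun c => by rw [mul_comm]; exact (norm_tmul c v).le

theorem tmulR_apply (c : E) (v : H) : tmulR E v c = tmul c v := rfl

variable [CompleteSpace H]

theorem ext_slice {y z : HT E H} (h : ∀ c, slice H c y = slice H c z) : y = z :=
  ext_inner_tmul fun c v => by rw [← inner_tmul_slice, ← inner_tmul_slice, h]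

theorem slice_tmul (c d : E) (v : H) : slice H c (tmul d v) = ⟪c, d⟫_ℂ • v := by
  refine ext_inner_left ℂ fun w => ?_
  rw [inner_tmul_slice, inner_tmul, inner_smul_right]

theorem inner_slice (c : E) (v : H) (z : HT E H) : ⟪slice H c z, v⟫_ℂ = ⟪z, tmul c v⟫_ℂ := by
  rw [← inner_conj_symm, inner_tmul_slice, inner_conj_symm]

variable [CompleteSpace E]

/-- For fixed `v`, the functional `c ↦ ⟪z, c ⊗ v⟫` is bounded and so represented by a vector of `E`;
vanishing on a basis then gives vanishing everywhere. -/
theorem eq_zero_of_slice_basis {ι : Type*} (e : HilbertBasis ι ℂ E) {z : HT E H}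
    (h : ∀ i, slice H (e i) z = 0) : z = 0 := by
  refine eq_zero_of_inner_tmul fun c v => ?_
  have h1 : ContinuousLinearMap.adjoint (tmulR E v) z = 0 := by
    refine HilbertBasis_eq_zero e fun i => ?_
    rw [ContinuousLinearMap.adjoint_inner_right, tmulR_apply, ← inner_tmul_slice, h,
      inner_zero_right]
  rw [← tmulR_apply, ← ContinuousLinearMap.adjoint_inner_right, h1, inner_zero_right]

/-- The tensor product of two orthonormal bases. -/
def HilbertBasis_tmul {ι κ : Type*} (e : HilbertBasis ι ℂ E) (h : HilbertBasis κ ℂ H) :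
    HilbertBasis (ι × κ) ℂ (HT E H) :=
  HilbertBasis.mkOfOrthogonalEqBot (orthonormal_tmul e.orthonormal h.orthonormal) <| by
    rw [eq_bot_iff]
    refine fun z hz => eq_zero_of_slice_basis e fun i => HilbertBasis_eq_zero h fun m => ?_
    rw [inner_tmul_slice]
    exact hz _ (Submodule.subset_span ⟨(i, m), rfl⟩)

theorem HilbertBasis_tmul_apply {ι κ : Type*} (e : HilbertBasis ι ℂ E) (h : HilbertBasis κ ℂ H)
    (p : ι × κ) : HilbertBasis_tmul e h p = tmul (e p.1) (h p.2) := by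
  rw [HilbertBasis_tmul, HilbertBasis.coe_mkOfOrthogonalEqBot]

theorem tsum_enorm_sq_slice {ι : Type*} (e : HilbertBasis ι ℂ E) (z : HT E H) :
    ∑' i, ‖slice H (e i) z‖ₑ ^ 2 = ‖z‖ₑ ^ 2 := by
  rw [← HilbertBasis_tsum_enorm_sq (HilbertBasis_tmul e (stdBasis H)), ENNReal.tsum_prod']
  refine tsum_congr fun i => ?_
  rw [← HilbertBasis_tsum_enorm_sq (stdBasis H)]
  refine tsum_congr fun m => ?_
  rw [HilbertBasis_tmul_apply, inner_tmul_slice]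

/-- The expansion `z = ∑ eᵢ ⊗ (⟨eᵢ| ⊗ I) z`. -/
theorem hasSum_tmul_slice {ι : Type*} (e : HilbertBasis ι ℂ E) (z : HT E H) :
    HasSum (fun i => tmul (e i) (slice H (e i) z)) z := by
  classical
  have hof : OrthogonalFamily ℂ (fun _ => H) (fun i =>
      ({ toLinearMap := (tmulL H (e i)).toLinearMap
         norm_map' := fun v => by
          have h : ‖tmul (e i) v‖ = ‖v‖ := by
            rw [norm_tmul, e.orthonormal.1 i, one_mul]
          exact h } : H →ₗᵢ[ℂ] HT E H)) := by
    intro i j hij v w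
    have h : ⟪tmul (e i) v, tmul (e j) w⟫_ℂ = 0 := by
      rw [inner_tmul, e.orthonormal.2 hij, zero_mul]
    exact h
  -- The terms are mutually orthogonal and their squared norms sum to `‖z‖²`. The remainder then has
  -- zero slices along the basis.
  have hs : Summable fun i => tmul (e i) (slice H (e i) z) := by
    refine (hof.summable_iff_norm_sq_summable (fun i => slice H (e i) z)).2 ?_
    rw [summable_norm_sq_iff, tsum_enorm_sq_slice e z]
    finiteness
  have h2 : z - ∑' i, tmul (e i) (slice H (e i) z) = 0 := by
    refine eq_zero_of_slice_basis e fun j => ?_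
    rw [map_sub, (slice H (e j)).map_tsum hs, tsum_eq_single j, slice_tmul,
      inner_self_eq_norm_sq_to_K, e.orthonormal.1 j]
    · simp
    · intro i hi
      rw [slice_tmul, e.orthonormal.2 hi.symm, zero_smul]
  have h3 := hs.hasSum
  rwa [← sub_eq_zero.1 h2] at h3

end Tensor

/-! ### Partial transposes of Hilbert-Schmidt operators -/

section Transpose

theorem Conjugation.inner_conj_left {E : Type*} [NormedAddCommGroup E] [InnerProductSpace ℂ E]
    (k : Conjugation E) (x y : E) : ⟪k.conj x, y⟫_ℂ = ⟪k.conj y, x⟫_ℂ := by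
  rw [← k.inner_conj, k.conj_conj]

theorem orthonormal_conj {E : Type*} [NormedAddCommGroup E] [InnerProductSpace ℂ E]
    (k : Conjugation E) {ι : Type*} {e : ι → E} (he : Orthonormal ℂ e) :
    Orthonormal ℂ fun i => k.conj (e i) := by
  refine ⟨fun i => by rw [LinearIsometryEquiv.norm_map]; exact he.1 i, fun i j hij => ?_⟩
  change ⟪k.conj (e i), k.conj (e j)⟫_ℂ = 0
  rw [k.inner_conj, he.2 hij.symm]

/-- The conjugate of an orthonormal basis. -/
def HilbertBasis_conj {E : Type*} [NormedAddCommGroup E] [InnerProductSpace ℂ E]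
    [CompleteSpace E] (k : Conjugation E) {ι : Type*} (e : HilbertBasis ι ℂ E) :
    HilbertBasis ι ℂ E :=
  HilbertBasis.mkOfOrthogonalEqBot (orthonormal_conj k e.orthonormal) <| by
    rw [eq_bot_iff]
    intro z hz
    have h : k.conj z = 0 := by
      refine HilbertBasis_eq_zero e fun i => ?_
      rw [← inner_conj_symm, k.inner_conj_left, hz _ (Submodule.subset_span ⟨i, rfl⟩), map_zero]
    rw [Submodule.mem_bot, ← k.conj_conj z, h, map_zero]

theorem HilbertBasis_conj_apply {E : Type*} [NormedAddCommGroup E] [InnerProductSpace ℂ E]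
    [CompleteSpace E] (k : Conjugation E) {ι : Type*} (e : HilbertBasis ι ℂ E) (i : ι) :
    HilbertBasis_conj k e i = k.conj (e i) := by
  rw [HilbertBasis_conj, HilbertBasis.coe_mkOfOrthogonalEqBot]

variable {E : Type u} [NormedAddCommGroup E] [InnerProductSpace ℂ E] [CompleteSpace E]
  {G : Type w} [NormedAddCommGroup G] [InnerProductSpace ℂ G]
  {H : Type v} [NormedAddCommGroup H] [InnerProductSpace ℂ H] [CompleteSpace H]
  (k₁ : Conjugation E) (k₂ : Conjugation G)

/-- This is the working form of the transpose: later identities between transposes are checked slice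
by slice. -/
theorem slice_hsTranspose (B : HS E (HT G H)) (c : E) (d : G) :
    slice H c (hsTranspose k₁ k₂ B d) =
      slice H (k₂.conj d) ((B : E →ₗ[ℂ] HT G H) (k₁.conj c)) := by
  refine ext_inner_left ℂ fun v => ?_
  rw [inner_tmul_slice, inner_tmul_slice, inner_hsTranspose]

theorem continuous_hsTranspose (B : HS E (HT G H)) : Continuous (hsTranspose k₁ k₂ B) := by
  let S := ∑' i, ‖(B : E →ₗ[ℂ] HT G H) (HilbertBasis_conj k₁ (stdBasis E) i)‖ₑ ^ 2
  have hS : S ≠ ⊤ := tsum_ne_top_of_mem_HS B.2 _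
  -- Parseval over the slices bounds `‖B_⊤ d‖` by `‖d‖` times the Hilbert-Schmidt norm of `B`,
  -- computed in the conjugate basis.
  have h1 : ∀ d, ‖hsTranspose k₁ k₂ B d‖ₑ ^ 2 ≤ ‖d‖ₑ ^ 2 * S := by
    intro d
    rw [← tsum_enorm_sq_slice (stdBasis E), ← ENNReal.tsum_mul_left]
    refine ENNReal.tsum_le_tsum fun i => ?_
    rw [slice_hsTranspose, HilbertBasis_conj_apply, ← mul_pow]
    gcongr
    have h2 := norm_slice_le (k₂.conj d) ((B : E →ₗ[ℂ] HT G H) (k₁.conj (stdBasis E i)))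
    rw [LinearIsometryEquiv.norm_map] at h2
    rw [← ofReal_norm, ← ofReal_norm, ← ofReal_norm, ← ENNReal.ofReal_mul (norm_nonneg _)]
    exact ENNReal.ofReal_le_ofReal h2
  refine AddMonoidHomClass.continuous_of_bound (hsTranspose k₁ k₂ B) (Real.sqrt S.toReal)
    fun d => ?_
  have h2 := ENNReal.toReal_mono (by finiteness) (h1 d)
  rw [ENNReal.toReal_mul, ENNReal.toReal_pow, ENNReal.toReal_pow, toReal_enorm, toReal_enorm] at h2
  refine abs_le_of_sq_le_sq' ?_ (by positivity) |>.2
  rw [mul_pow, Real.sq_sqrt ENNReal.toReal_nonneg]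
  linarith

variable [CompleteSpace G]

/-- The squared Hilbert-Schmidt norms of `B` and `B_⊤` are the same double sum of squared norms of
slices, in conjugate bases and in opposite orders of summation. -/
theorem hsTranspose_mem_HS (B : HS E (HT G H)) : hsTranspose k₁ k₂ B ∈ HS G (HT E H) := by
  refine mem_HS_of_basis (stdBasis G)
    ⟨hsTranspose k₁ k₂ B, continuous_hsTranspose k₁ k₂ B⟩ ?_
  change ∑' j, ‖hsTranspose k₁ k₂ B (stdBasis G j)‖ₑ ^ 2 ≠ ⊤
  have h : ∑' j, ‖hsTranspose k₁ k₂ B (stdBasis G j)‖ₑ ^ 2 =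
      ∑' i, ‖(B : E →ₗ[ℂ] HT G H) (HilbertBasis_conj k₁ (stdBasis E) i)‖ₑ ^ 2 := by
    simp_rw [← tsum_enorm_sq_slice (stdBasis E) (hsTranspose k₁ k₂ B _)]
    rw [ENNReal.tsum_comm]
    refine tsum_congr fun i => ?_
    rw [← tsum_enorm_sq_slice (HilbertBasis_conj k₂ (stdBasis G))]
    refine tsum_congr fun j => ?_
    rw [slice_hsTranspose, HilbertBasis_conj_apply, HilbertBasis_conj_apply]
  rw [h]
  exact tsum_ne_top_of_mem_HS B.2 _

end Transpose

/-! ### Ampliations and their adjoints -/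

section Tensor

variable {E : Type*} [NormedAddCommGroup E] [InnerProductSpace ℂ E]
  {E' : Type*} [NormedAddCommGroup E'] [InnerProductSpace ℂ E']
  {H : Type*} [NormedAddCommGroup H] [InnerProductSpace ℂ H]

theorem algTensor_hom_ext {D : Submodule ℂ H} {Y : Type*} [AddCommGroup Y] [Module ℂ Y]
    {S T : algTensor E D →ₗ[ℂ] Y}
    (h : ∀ c d (hd : d ∈ D), S ⟨tmul c d, tmul_mem_algTensor D c hd⟩ =
      T ⟨tmul c d, tmul_mem_algTensor D c hd⟩) : S = T := by
  have h1 : S ∘ₗ (algTensorEquiv E D).toLinearMap = T ∘ₗ (algTensorEquiv E D).toLinearMap :=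
    TensorProduct.ext' fun c d => h c d d.2
  ext z
  obtain ⟨t, rfl⟩ := (algTensorEquiv E D).surjective z
  exact congrArg (fun A => A t) h1

theorem ht_ext_tmul {Y : Type*} [NormedAddCommGroup Y] [InnerProductSpace ℂ Y]
    {A B : HT E H →L[ℂ] Y} (h : ∀ c v, A (tmul c v) = B (tmul c v)) : A = B := by
  refine ht_ext fun t => ?_
  induction t using TensorProduct.induction_on with
  | zero => simp
  | tmul c v => exact h c v
  | add a b ha hb => simp only [map_add, ha, hb]

/-- The adjoint of `A` is supplied as a second map `A'`, since `E` and `E'` need not be complete;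
the pairs used later are coordinate maps and embeddings, and the sum-flip. -/
theorem inner_htMap {A : E →L[ℂ] E'} {A' : E' →L[ℂ] E} {x x' : H →L[ℂ] H}
    (hA : ∀ c d, ⟪A c, d⟫_ℂ = ⟪c, A' d⟫_ℂ) (hx : ∀ v w, ⟪x v, w⟫_ℂ = ⟪v, x' w⟫_ℂ)
    (y : HT E H) (z : HT E' H) : ⟪htMap A x y, z⟫_ℂ = ⟪y, htMap A' x' z⟫_ℂ := by
  have h : ContinuousLinearMap.adjoint (htMap A x) = htMap A' x' := by
    refine ht_ext_tmul fun d w => ext_inner_tmul fun c v => ?_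
    rw [ContinuousLinearMap.adjoint_inner_right, htMap_tmul, htMap_tmul, inner_tmul, inner_tmul,
      hA, hx]
  rw [← h, ContinuousLinearMap.adjoint_inner_right]

theorem slice_htMap [CompleteSpace H] {A : E →L[ℂ] E'} {A' : E' →L[ℂ] E}
    (hA : ∀ c d, ⟪A c, d⟫_ℂ = ⟪c, A' d⟫_ℂ) (c : E) (z : HT E' H) :
    slice H c (htMap A' (ContinuousLinearMap.id ℂ H) z) = slice H (A c) z := by
  refine ext_inner_left ℂ fun v => ?_
  rw [inner_tmul_slice, inner_tmul_slice, ← inner_htMap (x := .id ℂ H) hA (fun _ _ => rfl),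
    htMap_tmul]
  rfl

theorem inner_ampl [CompleteSpace H] (x : H →L[ℂ] H) (y z : HT E H) :
    ⟪ampl E x y, z⟫_ℂ = ⟪y, ampl E (star x) z⟫_ℂ :=
  inner_htMap (fun _ _ => rfl)
    (fun v w => (ContinuousLinearMap.adjoint_inner_right x v w).symm) y z

theorem ampl_tmul (x : H →L[ℂ] H) (c : E) (v : H) : ampl E x (tmul c v) = tmul c (x v) :=
  htMap_tmul _ x c v

theorem ampl_one (z : HT E H) : ampl E (1 : H →L[ℂ] H) z = z :=
  congrArg (fun A => A z) htMap_id

theorem ampl_htMap (A : E →L[ℂ] E') (x : H →L[ℂ] H) (z : HT E H) :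
    ampl E' x (htMap A (ContinuousLinearMap.id ℂ H) z) =
      htMap A (ContinuousLinearMap.id ℂ H) (ampl E x z) := by
  have h : ampl E' x ∘L htMap A (ContinuousLinearMap.id ℂ H) =
      htMap A (ContinuousLinearMap.id ℂ H) ∘L ampl E x := by
    refine ht_ext_tmul fun c v => ?_
    rw [ContinuousLinearMap.comp_apply, ContinuousLinearMap.comp_apply, ampl_tmul, htMap_tmul,
      htMap_tmul, htMap_tmul]
    rfl
  exact congrArg (fun B => B z) h

theorem algAmp_tmul (A : E →L[ℂ] E') (D : Submodule ℂ H) (c : E) {d : H} (hd : d ∈ D) :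
    algAmp A D ⟨tmul c d, tmul_mem_algTensor D c hd⟩ =
      ⟨tmul (A c) d, tmul_mem_algTensor D (A c) hd⟩ :=
  Subtype.ext (htMap_tmul A _ c d)

theorem coe_algAmp (A : E →L[ℂ] E') (D : Submodule ℂ H) (z : algTensor E D) :
    (algAmp A D z : HT E' H) = htMap A (ContinuousLinearMap.id ℂ H) z := rfl

theorem htMap_comp_left {E'' : Type*} [NormedAddCommGroup E''] [InnerProductSpace ℂ E'']
    (B : E' →L[ℂ] E'') (A : E →L[ℂ] E') (z : HT E H) :
    htMap B (ContinuousLinearMap.id ℂ H) (htMap A (ContinuousLinearMap.id ℂ H) z) =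
      htMap (B ∘L A) (ContinuousLinearMap.id ℂ H) z := by
  have h : htMap B (ContinuousLinearMap.id ℂ H) ∘L htMap A (ContinuousLinearMap.id ℂ H) =
      htMap (B ∘L A) (ContinuousLinearMap.id ℂ H) := by
    refine ht_ext_tmul fun c v => ?_
    rw [ContinuousLinearMap.comp_apply, htMap_tmul, htMap_tmul, htMap_tmul]
    rfl
  exact congrArg (fun C => C z) h

theorem htMap_zero_left (z : HT E H) :
    htMap (0 : E →L[ℂ] E') (ContinuousLinearMap.id ℂ H) z = 0 := by
  have h : htMap (0 : E →L[ℂ] E') (ContinuousLinearMap.id ℂ H) = 0 := by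
    refine ht_ext_tmul fun c v => ?_
    rw [htMap_tmul]
    exact (tmulR E' v).map_zero
  exact congrArg (fun A => A z) h

end Tensor

/-! ### Formal adjoints -/

section FormalDagger

variable {X : Type*} [NormedAddCommGroup X] [InnerProductSpace ℂ X]
  {Y : Type*} [NormedAddCommGroup Y] [InnerProductSpace ℂ Y]

/-- The operators `T` and `S`, with domains `D₁` and `D₂`, are formally adjoint. -/
def FormalDagger {D₁ : Submodule ℂ X} {D₂ : Submodule ℂ Y} (T : D₁ →ₗ[ℂ] Y) (S : D₂ →ₗ[ℂ] X) :
    Prop :=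
  ∀ (y : D₂) (x : D₁), ⟪S y, (x : X)⟫_ℂ = ⟪(y : Y), T x⟫_ℂ

variable {D₁ : Submodule ℂ X} {D₂ : Submodule ℂ Y} {T T' : D₁ →ₗ[ℂ] Y} {S S' : D₂ →ₗ[ℂ] X}

theorem FormalDagger.symm (h : FormalDagger T S) : FormalDagger S T := fun x y => by
  rw [← inner_conj_symm, ← h, inner_conj_symm]

theorem FormalDagger.add (h : FormalDagger T S) (h' : FormalDagger T' S') :
    FormalDagger (T + T') (S + S') := fun y x => by
  rw [LinearMap.add_apply, LinearMap.add_apply, inner_add_left, inner_add_right, h, h']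

theorem FormalDagger.mem_OpDag [CompleteSpace X] (h : FormalDagger T S) : T ∈ OpDag D₁ D₂ := by
  intro y hy
  rw [LinearPMap.mem_adjoint_domain_iff]
  have e : (fun x : D₁ => ⟪S ⟨y, hy⟩, (x : X)⟫_ℂ) = fun x : D₁ => ⟪y, T x⟫_ℂ :=
    funext fun x => h ⟨y, hy⟩ x
  change Continuous (fun x : D₁ => ⟪y, T x⟫_ℂ)
  rw [← e]
  fun_prop

/-- With a dense domain, `T†` can be computed by exhibiting any formal adjoint on the same domain.
-/
theorem FormalDagger.unique (hD : Dense (D₁ : Set X)) (h : FormalDagger T S)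
    (h' : FormalDagger T S') : S = S' := by
  ext y
  refine hD.eq_of_inner_left ℂ fun x hx => ?_
  rw [h y ⟨x, hx⟩, h' y ⟨x, hx⟩]

end FormalDagger

section FormalDaggerTensor

variable {E : Type*} [NormedAddCommGroup E] [InnerProductSpace ℂ E]
  {E' : Type*} [NormedAddCommGroup E'] [InnerProductSpace ℂ E']
  {F : Type*} [NormedAddCommGroup F] [InnerProductSpace ℂ F]
  {H : Type*} [NormedAddCommGroup H] [InnerProductSpace ℂ H] {D : Submodule ℂ H}

theorem formalDagger_of_tmul {T : algTensor E D →ₗ[ℂ] HT F H} {S : algTensor F D →ₗ[ℂ] HT E H}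
    (h : ∀ (c : E) (d : F) (v w : H) (hv : v ∈ D) (hw : w ∈ D),
      ⟪S ⟨tmul d w, tmul_mem_algTensor D d hw⟩, tmul c v⟫_ℂ =
        ⟪tmul d w, T ⟨tmul c v, tmul_mem_algTensor D c hv⟩⟫_ℂ) : FormalDagger T S := by
  have h1 : ∀ (d : F) (w : H) (hw : w ∈ D) (x : algTensor E D),
      ⟪S ⟨tmul d w, tmul_mem_algTensor D d hw⟩, (x : HT E H)⟫_ℂ = ⟪tmul d w, T x⟫_ℂ := by
    intro d w hw x
    have e : (innerₛₗ ℂ (S ⟨tmul d w, tmul_mem_algTensor D d hw⟩)) ∘ₗ (algTensor E D).subtype =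
        (innerₛₗ ℂ (tmul d w)) ∘ₗ T := algTensor_hom_ext fun c v hv => h c d v w hv hw
    exact congrArg (fun A => A x) e
  intro y x
  -- Extension from simple tensors needs linear maps, and the inner product is linear only in its
  -- second slot, so the roles are exchanged by conjugation.
  rw [← inner_conj_symm, ← inner_conj_symm (y : HT F H)]
  have e : (innerₛₗ ℂ (x : HT E H)) ∘ₗ S = (innerₛₗ ℂ (T x)) ∘ₗ (algTensor F D).subtype := by
    refine algTensor_hom_ext fun d w hw => ?_
    change ⟪(x : HT E H), S _⟫_ℂ = ⟪T x, tmul d w⟫_ℂ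
    rw [← inner_conj_symm, h1 d w hw, inner_conj_symm]
  exact congrArg (starRingEnd ℂ) (congrArg (fun A => A y) e)

theorem FormalDagger.comp_left {T : algTensor E D →ₗ[ℂ] HT F H}
    {S : algTensor F D →ₗ[ℂ] HT E H} (h : FormalDagger T S) {A : F →L[ℂ] E'} {A' : E' →L[ℂ] F}
    (hA : ∀ c d, ⟪A c, d⟫_ℂ = ⟪c, A' d⟫_ℂ) :
    FormalDagger (ampI H A ∘ₗ T) (S ∘ₗ algAmp A' D) := fun y x => by
  have h1 := h (algAmp A' D y) x
  rw [coe_algAmp] at h1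
  change ⟪S (algAmp A' D y), (x : HT E H)⟫_ℂ = ⟪(y : HT E' H), htMap A _ (T x)⟫_ℂ
  rw [h1, ← inner_conj_symm, ← inner_htMap (x := .id ℂ H) hA (fun _ _ => rfl), inner_conj_symm]

theorem FormalDagger.comp_right {T : algTensor E D →ₗ[ℂ] HT F H}
    {S : algTensor F D →ₗ[ℂ] HT E H} (h : FormalDagger T S) {A : E →L[ℂ] E'} {A' : E' →L[ℂ] E}
    (hA : ∀ c d, ⟪A c, d⟫_ℂ = ⟪c, A' d⟫_ℂ) :
    FormalDagger (T ∘ₗ algAmp A' D) (ampI H A ∘ₗ S) :=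
  (h.symm.comp_left hA).symm

end FormalDaggerTensor

/-! ### Operators affiliated to `M` are determined on `E ⊗ ξ` -/

section Affiliated

variable {H : Type v} [NormedAddCommGroup H] [InnerProductSpace ℂ H] [CompleteSpace H]
  (M : VonNeumannAlgebra H) (ξ : H)
  {E : Type u} [NormedAddCommGroup E] [InnerProductSpace ℂ E]
  {E' : Type*} [NormedAddCommGroup E'] [InnerProductSpace ℂ E']
  {F : Type w} [NormedAddCommGroup F] [InnerProductSpace ℂ F]

variable {M ξ}

theorem ampl_mem_algTensor {x : H →L[ℂ] H} (hx : x ∈ M.commutant) {z : HT E H}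
    (hz : z ∈ algTensor E (Xi M ξ)) : ampl E x z ∈ algTensor E (Xi M ξ) :=
  htMap_mem_algTensor _ _ (fun _ hd => apply_mem_Xi M ξ hx hd) hz

/-- An operator which is affiliated to `M` intertwines all operators in `M'`. -/
theorem OpM_apply_ampl {T : algTensor E (Xi M ξ) →ₗ[ℂ] HT F H} (hT : T ∈ OpM M ξ E F)
    {x : H →L[ℂ] H} (hx : x ∈ M.commutant) (z : algTensor E (Xi M ξ)) :
    T ⟨ampl E x z, ampl_mem_algTensor hx z.2⟩ = ampl F x (T z) := by
  -- The argument of `T` carries a proof of membership. Putting it inside the predicate makes the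
  -- predicate stable under sums and multiples.
  suffices h : ∃ h : ampl E x z ∈ algTensor E (Xi M ξ), T ⟨ampl E x z, h⟩ = ampl F x (T z) from
    h.2
  refine vonNeumann_induction_unitary M.commutant
    (p := fun x => ∃ h : ampl E x z ∈ algTensor E (Xi M ξ), T ⟨ampl E x z, h⟩ = ampl F x (T z))
    (fun u hu huu => ?_) ?_ ?_ ?_ hx
  · refine ⟨ampl_mem_algTensor hu z.2, ?_⟩
    have h1 := (hT u hu huu z).2 z.2 (ampl_mem_algTensor hu z.2)
    have h2 := congrArg (ampl F u) h1
    rw [htMap_comp_right, (Unitary.mem_iff.1 huu).2] at h2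
    exact (ampl_one _).symm.trans h2
  · have h1 : ampl E (0 : H →L[ℂ] H) (z : HT E H) = 0 := by
      have h := congrArg (fun A => A (z : HT E H))
        (htMap_smul_right (ContinuousLinearMap.id ℂ E) 0 (0 : H →L[ℂ] H))
      simpa using h
    have h2 : ampl F (0 : H →L[ℂ] H) (T z) = 0 := by
      have h := congrArg (fun A => A (T z))
        (htMap_smul_right (ContinuousLinearMap.id ℂ F) 0 (0 : H →L[ℂ] H))
      simpa using h
    refine ⟨h1 ▸ zero_mem _, ?_⟩
    rw [h2, ← T.map_zero]
    exact congrArg T (Subtype.ext h1)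
  · rintro x y ⟨hx, hx'⟩ ⟨hy, hy'⟩
    have h1 : ampl E (x + y) (z : HT E H) = ampl E x z + ampl E y z :=
      congrArg (fun A => A (z : HT E H)) (htMap_add_right (.id ℂ E) x y)
    have h2 : ampl F (x + y) (T z) = ampl F x (T z) + ampl F y (T z) :=
      congrArg (fun A => A (T z)) (htMap_add_right (.id ℂ F) x y)
    refine ⟨h1 ▸ add_mem hx hy, ?_⟩
    rw [h2, ← hx', ← hy', ← T.map_add]
    exact congrArg T (Subtype.ext h1)
  · rintro a x ⟨hx, hx'⟩
    have h1 : ampl E (a • x) (z : HT E H) = a • ampl E x z :=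
      congrArg (fun A => A (z : HT E H)) (htMap_smul_right (.id ℂ E) a x)
    have h2 : ampl F (a • x) (T z) = a • ampl F x (T z) :=
      congrArg (fun A => A (T z)) (htMap_smul_right (.id ℂ F) a x)
    refine ⟨h1 ▸ Submodule.smul_mem _ a hx, ?_⟩
    rw [h2, ← hx', ← T.map_smul]
    exact congrArg T (Subtype.ext h1)

theorem OpM_apply_tmul {T : algTensor E (Xi M ξ) →ₗ[ℂ] HT F H} (hT : T ∈ OpM M ξ E F)
    {x : H →L[ℂ] H} (hx : x ∈ M.commutant) (c : E) {v : H} (hv : v = x ξ) (h : v ∈ Xi M ξ) :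
    T ⟨tmul c v, tmul_mem_algTensor _ c h⟩ = ampl F x (T (Evec M ξ E c)) := by
  subst hv
  rw [← OpM_apply_ampl hT hx]
  exact congrArg T (Subtype.ext (ampl_tmul x c ξ).symm)

/-- As `Ξ = M'ξ`, the intertwining property recovers `T` from `T E_ξ`. -/
theorem OpM_ext {S T : algTensor E (Xi M ξ) →ₗ[ℂ] HT F H} (hS : S ∈ OpM M ξ E F)
    (hT : T ∈ OpM M ξ E F) (h : ∀ c, S (Evec M ξ E c) = T (Evec M ξ E c)) : S = T := by
  refine algTensor_hom_ext fun c v hv => ?_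
  obtain ⟨x, hx, hvx⟩ := mem_orbit.1 hv
  rw [OpM_apply_tmul hS hx c hvx hv, OpM_apply_tmul hT hx c hvx hv, h]

theorem OpM_comp_left {T : algTensor E (Xi M ξ) →ₗ[ℂ] HT F H} (hT : T ∈ OpM M ξ E F)
    (A : F →L[ℂ] E') : ampI H A ∘ₗ T ∈ OpM M ξ E E' := fun u hu huu z =>
  ⟨ampl_mem_iff M ξ hu huu z, fun hz huz => by
    have h := (hT u hu huu z).2 hz huz
    change ampl E' (star u) (htMap A _ (T _)) = htMap A _ (T _)
    rw [ampl_htMap, h]⟩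

theorem OpM_comp_right {T : algTensor E (Xi M ξ) →ₗ[ℂ] HT F H} (hT : T ∈ OpM M ξ E F)
    (A : E' →L[ℂ] E) : T ∘ₗ algAmp A (Xi M ξ) ∈ OpM M ξ E' F := fun u hu huu z =>
  ⟨ampl_mem_iff M ξ hu huu z, fun hz huz => by
    rw [LinearMap.comp_apply, LinearMap.comp_apply]
    have h := (hT u hu huu (algAmp A (Xi M ξ) ⟨z, hz⟩)).2 (algAmp A (Xi M ξ) ⟨z, hz⟩).2
      (ampl_mem_algTensor hu (algAmp A (Xi M ξ) ⟨z, hz⟩).2)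
    refine Eq.trans ?_ h
    congr 2
    exact Subtype.ext (ampl_htMap A u z).symm⟩

theorem algAmp_Evec (A : E' →L[ℂ] E) (c : E') :
    algAmp A (Xi M ξ) (Evec M ξ E' c) = Evec M ξ E (A c) :=
  algAmp_tmul A _ c (vector_mem_Xi M ξ)

variable [CompleteSpace E]

theorem Mat_comp_left {T : algTensor E (Xi M ξ) →ₗ[ℂ] HT F H} (hT : T ∈ Mat M ξ E F)
    (A : F →L[ℂ] E') : ampI H A ∘ₗ T ∈ Mat M ξ E E' :=
  ⟨OpM_comp_left hT.1 A, HS_comp_left hT.2 (htMap A (ContinuousLinearMap.id ℂ H))⟩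

theorem Mat_comp_right [CompleteSpace E']
    {T : algTensor E (Xi M ξ) →ₗ[ℂ] HT F H} (hT : T ∈ Mat M ξ E F)
    (A : E' →L[ℂ] E) : T ∘ₗ algAmp A (Xi M ξ) ∈ Mat M ξ E' F := by
  refine ⟨OpM_comp_right hT.1 A, ?_⟩
  have h : compEvec M ξ E' F (T ∘ₗ algAmp A (Xi M ξ)) = compEvec M ξ E F T ∘ₗ A.toLinearMap := by
    ext c
    exact congrArg T (algAmp_Evec A c)
  change compEvec M ξ E' F (T ∘ₗ algAmp A (Xi M ξ)) ∈ HS E' (HT F H)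
  rw [h]
  exact HS_comp_right hT.2 A

end Affiliated

/-! ### Adjointable matrices -/

section Dagger

variable {H : Type v} [NormedAddCommGroup H] [InnerProductSpace ℂ H] [CompleteSpace H]
  {M : VonNeumannAlgebra H} {ξ : H} [IsCyclicSeparating M ξ]
  {E : Type u} [NormedAddCommGroup E] [InnerProductSpace ℂ E]
  {F : Type w} [NormedAddCommGroup F] [InnerProductSpace ℂ F]

theorem dense_algTensor_Xi : Dense (algTensor E (Xi M ξ) : Set (HT E H)) :=
  dense_algTensor (dense_Xi M ξ)

theorem formalDagger_matDagger (T : MatDag M ξ E F) : FormalDagger T.1 (matDagger M ξ T).1 :=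
  fun y x => inner_dagger dense_algTensor_Xi ⟨T.1, T.2.2.fst⟩ y x

/-- Density of `E ⊙ Ξ` forces `S` to be `T†`. Adjointability below is always proved by exhibiting
such an `S`, or by closure properties deduced from this. -/
theorem FormalDagger.mem_MatDag {T : algTensor E (Xi M ξ) →ₗ[ℂ] HT F H}
    {S : algTensor F (Xi M ξ) →ₗ[ℂ] HT E H} (h : FormalDagger T S) (hT : T ∈ Mat M ξ E F)
    (hS : S ∈ Mat M ξ F E) : T ∈ MatDag M ξ E F := by
  refine ⟨hT, h.mem_OpDag, ?_⟩
  have e : dagger ⟨T, h.mem_OpDag⟩ = S := FormalDagger.unique (T := T) dense_algTensor_Xi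
    (fun y x => inner_dagger dense_algTensor_Xi ⟨T, h.mem_OpDag⟩ y x) h
  rwa [e]

theorem FormalDagger.matDagger_eq {T : MatDag M ξ E F}
    {S : algTensor F (Xi M ξ) →ₗ[ℂ] HT E H} (h : FormalDagger T.1 S) :
    (matDagger M ξ T).1 = S :=
  (formalDagger_matDagger T).unique dense_algTensor_Xi h

theorem matDagger_mem_MatDag (T : MatDag M ξ E F) : (matDagger M ξ T).1 ∈ MatDag M ξ F E :=
  (formalDagger_matDagger T).symm.mem_MatDag (matDagger M ξ T).2 T.2.1

variable {E' : Type*} [NormedAddCommGroup E'] [InnerProductSpace ℂ E'] [CompleteSpace E']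

theorem MatDag_comp_left [CompleteSpace E] [CompleteSpace F]
    {T : algTensor E (Xi M ξ) →ₗ[ℂ] HT F H} (hT : T ∈ MatDag M ξ E F)
    {A : F →L[ℂ] E'} {A' : E' →L[ℂ] F} (hA : ∀ c d, ⟪A c, d⟫_ℂ = ⟪c, A' d⟫_ℂ) :
    ampI H A ∘ₗ T ∈ MatDag M ξ E E' :=
  ((formalDagger_matDagger ⟨T, hT⟩).comp_left hA).mem_MatDag (Mat_comp_left hT.1 A)
    (Mat_comp_right (matDagger M ξ ⟨T, hT⟩).2 A')

theorem MatDag_comp_right [CompleteSpace E] [CompleteSpace F]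
    {T : algTensor E (Xi M ξ) →ₗ[ℂ] HT F H} (hT : T ∈ MatDag M ξ E F)
    {A : E →L[ℂ] E'} {A' : E' →L[ℂ] E} (hA : ∀ c d, ⟪A c, d⟫_ℂ = ⟪c, A' d⟫_ℂ) :
    T ∘ₗ algAmp A' (Xi M ξ) ∈ MatDag M ξ E' F :=
  ((formalDagger_matDagger ⟨T, hT⟩).comp_right hA).mem_MatDag (Mat_comp_right hT.1 A')
    (Mat_comp_left (matDagger M ξ ⟨T, hT⟩).2 A)

end Dagger

/-! ### The matrix transpose and the conjugate -/

section Transpose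

variable {H : Type v} [NormedAddCommGroup H] [InnerProductSpace ℂ H] [CompleteSpace H]
  {M : VonNeumannAlgebra H} {ξ : H} [IsCyclicSeparating M ξ]
  {E : Type u} [NormedAddCommGroup E] [InnerProductSpace ℂ E]
  {F : Type w} [NormedAddCommGroup F] [InnerProductSpace ℂ F]

theorem supXi_Evec (B : E →ₗ[ℂ] HT F H) (c : E) : supXi M ξ B (Evec M ξ E c) = B c :=
  (supXi_apply M ξ B c (one_mem M.commutant)).trans (ampl_one _)

/-- On `c ⊗ xξ` the claim is `(I ⊗ u*)(I ⊗ ux) B c = (I ⊗ x) B c`. -/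
theorem supXi_mem_OpM (B : E →ₗ[ℂ] HT F H) : supXi M ξ B ∈ OpM M ξ E F := by
  intro u hu huu z
  refine ⟨ampl_mem_iff M ξ hu huu z, fun hz huz => ?_⟩
  let U : algTensor E (Xi M ξ) →ₗ[ℂ] algTensor E (Xi M ξ) :=
    (ampl E u).toLinearMap.restrict fun _ hz => ampl_mem_algTensor hu hz
  have h : (ampl F (star u)).toLinearMap ∘ₗ supXi M ξ B ∘ₗ U = supXi M ξ B := by
    refine algTensor_hom_ext fun c v hv => ?_
    obtain ⟨x, hx, rfl⟩ := mem_orbit.1 hv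
    have h1 : U ⟨tmul c (x ξ), tmul_mem_algTensor _ c hv⟩ =
        ⟨tmul c ((u * x) ξ), tmul_mem_algTensor _ c (mem_orbit.2 ⟨u * x, mul_mem hu hx, rfl⟩)⟩ :=
      Subtype.ext (ampl_tmul u c (x ξ))
    rw [LinearMap.comp_apply, LinearMap.comp_apply, h1, supXi_apply M ξ B c (mul_mem hu hx),
      supXi_apply M ξ B c hx]
    change ampl F (star u) (ampl F (u * x) (B c)) = _
    rw [htMap_comp_right, ← mul_assoc, (Unitary.mem_iff.1 huu).1, one_mul]
  exact congrArg (fun A => A ⟨z, hz⟩) h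

variable [CompleteSpace E] (k₁ : Conjugation E) (k₂ : Conjugation F)

theorem slice_matTranspose (T : Mat M ξ E F) (c : E) (d : F) :
    slice H c (matTranspose M ξ k₁ k₂ T (Evec M ξ F d)) =
      slice H (k₂.conj d) (T.1 (Evec M ξ E (k₁.conj c))) := by
  rw [matTranspose, supXi_Evec, slice_hsTranspose]
  rfl

/-- Affiliation reduces equality to the vectors `d ⊗ ξ`, and slices separate points; transposes are
computed with this criterion. -/
theorem eq_matTranspose {T : Mat M ξ E F} {S : algTensor F (Xi M ξ) →ₗ[ℂ] HT E H}
    (hS : S ∈ OpM M ξ F E) (h : ∀ c d, slice H c (S (Evec M ξ F d)) =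
      slice H (k₂.conj d) (T.1 (Evec M ξ E (k₁.conj c)))) : matTranspose M ξ k₁ k₂ T = S :=
  OpM_ext (supXi_mem_OpM _) hS fun d => ext_slice fun c => by
    rw [slice_matTranspose, h]

variable [CompleteSpace F]

theorem matTranspose_mem (T : Mat M ξ E F) : matTranspose M ξ k₁ k₂ T ∈ Mat M ξ F E := by
  refine ⟨supXi_mem_OpM _, ?_⟩
  have h : compEvec M ξ F E (matTranspose M ξ k₁ k₂ T) =
      hsTranspose k₁ k₂ ⟨compEvec M ξ E F T, T.2.2⟩ := LinearMap.ext fun d => supXi_Evec _ d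
  change compEvec M ξ F E (matTranspose M ξ k₁ k₂ T) ∈ HS F (HT E H)
  rw [h]
  exact hsTranspose_mem_HS k₁ k₂ _

theorem matTranspose_matTranspose (T : Mat M ξ E F) :
    matTranspose M ξ k₂ k₁ ⟨matTranspose M ξ k₁ k₂ T, matTranspose_mem k₁ k₂ T⟩ = T.1 :=
  eq_matTranspose _ _ T.2.1 fun c d => by
    rw [slice_matTranspose, k₁.conj_conj, k₂.conj_conj]

/-- The matrix transpose, as a linear isomorphism. -/
def matTransposeEquiv : Mat M ξ E F ≃ₗ[ℂ] Mat M ξ F E where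
  toFun T := ⟨matTranspose M ξ k₁ k₂ T, matTranspose_mem k₁ k₂ T⟩
  invFun T := ⟨matTranspose M ξ k₂ k₁ T, matTranspose_mem k₂ k₁ T⟩
  map_add' S T := Subtype.ext <| eq_matTranspose _ _
    (add_mem (matTranspose_mem k₁ k₂ S).1 (matTranspose_mem k₁ k₂ T).1) fun c d => by
      refine ((slice H c).map_add _ _).trans ?_
      rw [slice_matTranspose, slice_matTranspose, ← map_add]
      rfl
  map_smul' a T := Subtype.ext <| eq_matTranspose _ _
    (Submodule.smul_mem _ a (matTranspose_mem k₁ k₂ T).1) fun c d => by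
      refine ((slice H c).map_smul a _).trans ?_
      rw [slice_matTranspose, ← map_smul]
      rfl
  left_inv T := Subtype.ext (matTranspose_matTranspose k₁ k₂ T)
  right_inv T := Subtype.ext (matTranspose_matTranspose k₂ k₁ T)

theorem matTranspose_add (S T : Mat M ξ E F) : matTranspose M ξ k₁ k₂ (S + T) =
    matTranspose M ξ k₁ k₂ S + matTranspose M ξ k₁ k₂ T :=
  congrArg Subtype.val (map_add (matTransposeEquiv k₁ k₂) S T)

variable {E' : Type*} [NormedAddCommGroup E'] [InnerProductSpace ℂ E'] (k' : Conjugation E')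

/-- The transpose of `A` is the conjugate of its adjoint; `hk` says that `A'` is real, so adjoint
and transpose coincide. -/
theorem matTranspose_comp_left (T : Mat M ξ E F) {A : F →L[ℂ] E'} {A' : E' →L[ℂ] F}
    (hA : ∀ c d, ⟪A c, d⟫_ℂ = ⟪c, A' d⟫_ℂ) (hk : ∀ d, A' (k'.conj d) = k₂.conj (A' d)) :
    matTranspose M ξ k₁ k' ⟨ampI H A ∘ₗ T.1, Mat_comp_left T.2 A⟩ =
      matTranspose M ξ k₁ k₂ T ∘ₗ algAmp A' (Xi M ξ) := by
  refine eq_matTranspose _ _ (OpM_comp_right (matTranspose_mem k₁ k₂ T).1 A') fun c d => ?_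
  have hA' : ∀ c d, ⟪A' c, d⟫_ℂ = ⟪c, A d⟫_ℂ := fun c d => by
    rw [← inner_conj_symm, ← hA, inner_conj_symm]
  rw [LinearMap.comp_apply, algAmp_Evec, slice_matTranspose, ← hk]
  exact (slice_htMap hA' _ _).symm

theorem matTranspose_comp_right [CompleteSpace E'] (T : Mat M ξ E F)
    {A : E →L[ℂ] E'} {A' : E' →L[ℂ] E}
    (hA : ∀ c d, ⟪A c, d⟫_ℂ = ⟪c, A' d⟫_ℂ) (hk : ∀ d, A' (k'.conj d) = k₁.conj (A' d)) :
    matTranspose M ξ k' k₂ ⟨T.1 ∘ₗ algAmp A' (Xi M ξ), Mat_comp_right T.2 A'⟩ =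
      ampI H A ∘ₗ matTranspose M ξ k₁ k₂ T := by
  refine eq_matTranspose _ _ (OpM_comp_left (matTranspose_mem k₁ k₂ T).1 A) fun c d => ?_
  have hA' : ∀ c d, ⟪A' c, d⟫_ℂ = ⟪c, A d⟫_ℂ := fun c d => by
    rw [← inner_conj_symm, ← hA, inner_conj_symm]
  rw [LinearMap.comp_apply, LinearMap.comp_apply, algAmp_Evec, hk, ← slice_matTranspose]
  exact slice_htMap hA' _ _

/-- The transpose of `T` is the formal adjoint of the conjugate of `T`. -/
theorem formalDagger_matConj (T : MatDag M ξ E F) :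
    FormalDagger (matConj M ξ k₁ k₂ T) (matTranspose M ξ k₁ k₂ ⟨T.1, T.2.1⟩) := by
  refine formalDagger_of_tmul fun c d v w hv hw => ?_
  obtain ⟨x, hx, hvx⟩ := mem_orbit.1 hv
  obtain ⟨y, hy, hwy⟩ := mem_orbit.1 hw
  rw [OpM_apply_tmul (matTranspose_mem k₁ k₂ ⟨T.1, T.2.1⟩).1 hy d hwy hw, matConj,
    OpM_apply_tmul (matTranspose_mem k₂ k₁ (matDagger M ξ T)).1 hx c hvx hv, inner_ampl, ampl_tmul,
    ← inner_slice, slice_matTranspose, inner_slice, ← inner_conj_symm (tmul d w), inner_ampl,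
    ampl_tmul, inner_conj_symm, ← inner_tmul_slice, slice_matTranspose, inner_tmul_slice]
  -- Both sides now involve only `T` on `c̄ ⊗ Ξ`, paired with `d̄ ⊗ Ξ`. They agree because `T`
  -- intertwines `x*y ∈ M'`, whose adjoint `y*x` acts on the other side.
  have hxy : star x * y ∈ M.commutant := mul_mem (star_mem hx) hy
  have hm : (star x) w = (star x * y) ξ := by rw [hwy]; rfl
  have hm' : (star x) w ∈ Xi M ξ := apply_mem_Xi M ξ (star_mem hx) hw
  have h1 := (formalDagger_matDagger T).symm
    ⟨tmul (k₁.conj c) ((star x) w), tmul_mem_algTensor _ _ hm'⟩ (Evec M ξ F (k₂.conj d))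
  rw [← h1, OpM_apply_tmul T.2.1.1 hxy _ hm hm', inner_ampl]
  have h2 : star (star x * y) = star y * x := by rw [star_mul, star_star]
  rw [h2]
  change _ = ⟪_, ampl F (star y * x) (tmul (k₂.conj d) ξ)⟫_ℂ
  rw [ampl_tmul, hvx]
  rfl

theorem matConj_mem_MatDag (T : MatDag M ξ E F) : matConj M ξ k₁ k₂ T ∈ MatDag M ξ E F :=
  (formalDagger_matConj k₁ k₂ T).mem_MatDag (matTranspose_mem _ _ _) (matTranspose_mem _ _ _)

theorem matTranspose_mem_MatDag {T : Mat M ξ E F} (hT : T.1 ∈ MatDag M ξ E F) :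
    matTranspose M ξ k₁ k₂ T ∈ MatDag M ξ F E :=
  (formalDagger_matConj k₁ k₂ ⟨T.1, hT⟩).symm.mem_MatDag (matTranspose_mem _ _ _)
    (matTranspose_mem _ _ _)

theorem mem_MatDag_of_matTranspose {T : Mat M ξ E F}
    (hT : matTranspose M ξ k₁ k₂ T ∈ MatDag M ξ F E) : T.1 ∈ MatDag M ξ E F := by
  rw [← matTranspose_matTranspose k₁ k₂ T]
  exact matTranspose_mem_MatDag k₂ k₁ hT

end Transpose

/-! ### Block decompositions and the sum-flip -/

section Blocks

variable {E : Type*} [NormedAddCommGroup E] [InnerProductSpace ℂ E]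
  {F : Type*} [NormedAddCommGroup F] [InnerProductSpace ℂ F]
  {H : Type*} [NormedAddCommGroup H] [InnerProductSpace ℂ H]

theorem htMap_prL_inL (z : HT E H) :
    htMap (prL E F) (.id ℂ H) (htMap (inL E F) (.id ℂ H) z) = z := by
  rw [htMap_comp_left]
  exact congrArg (fun A => A z) htMap_id

theorem htMap_prR_inR (z : HT F H) :
    htMap (prR E F) (.id ℂ H) (htMap (inR E F) (.id ℂ H) z) = z := by
  rw [htMap_comp_left]
  exact congrArg (fun A => A z) htMap_id

theorem htMap_prR_inL (z : HT E H) :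
    htMap (prR E F) (.id ℂ H) (htMap (inL E F) (.id ℂ H) z) = 0 := by
  rw [htMap_comp_left]
  exact htMap_zero_left z

theorem htMap_prL_inR (z : HT F H) :
    htMap (prL E F) (.id ℂ H) (htMap (inR E F) (.id ℂ H) z) = 0 := by
  rw [htMap_comp_left]
  exact htMap_zero_left z

theorem htMap_inL_prL_add (z : HT (HSum E F) H) :
    htMap (inL E F) (.id ℂ H) (htMap (prL E F) (.id ℂ H) z) +
      htMap (inR E F) (.id ℂ H) (htMap (prR E F) (.id ℂ H) z) = z := by
  have h : htMap (inL E F) (.id ℂ H) ∘L htMap (prL E F) (.id ℂ H) +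
      htMap (inR E F) (.id ℂ H) ∘L htMap (prR E F) (.id ℂ H) = .id ℂ (HT (HSum E F) H) := by
    refine ht_ext_tmul fun c v => ?_
    change htMap _ _ (htMap _ _ (tmul c v)) + htMap _ _ (htMap _ _ (tmul c v)) = tmul c v
    rw [htMap_tmul, htMap_tmul, htMap_tmul, htMap_tmul]
    conv_rhs => rw [← inL_prL_add_inR_prR c, add_tmul]
    rfl
  exact congrArg (fun A => A z) h

variable (D : Submodule ℂ H)

theorem algAmp_prL_inL (z : algTensor E D) : algAmp (prL E F) D (algAmp (inL E F) D z) = z :=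
  Subtype.ext (htMap_prL_inL _)

theorem algAmp_prR_inR (z : algTensor F D) : algAmp (prR E F) D (algAmp (inR E F) D z) = z :=
  Subtype.ext (htMap_prR_inR _)

theorem inner_sumFlip (x y : HSum E E) : ⟪sumFlip E x, y⟫_ℂ = ⟪x, sumFlip E y⟫_ℂ := by
  rw [WithLp.prod_inner_apply, WithLp.prod_inner_apply]
  exact add_comm _ _

theorem sumFlip_conj (k : Conjugation E) (x : HSum E E) :
    sumFlip E ((k.sum k).conj x) = (k.sum k).conj (sumFlip E x) := rfl

theorem htMap_sumFlip_inL (z : HT E H) :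
    htMap (sumFlip E) (.id ℂ H) (htMap (inL E E) (.id ℂ H) z) = htMap (inR E E) (.id ℂ H) z := by
  rw [htMap_comp_left]
  rfl

theorem htMap_sumFlip_inR (z : HT E H) :
    htMap (sumFlip E) (.id ℂ H) (htMap (inR E E) (.id ℂ H) z) = htMap (inL E E) (.id ℂ H) z := by
  rw [htMap_comp_left]
  rfl

end Blocks

/-! ### Off-diagonal matrices and the column isomorphism -/

section Column

variable {H : Type v} [NormedAddCommGroup H] [InnerProductSpace ℂ H] [CompleteSpace H]
  {K : Type u} [NormedAddCommGroup K] [InnerProductSpace ℂ K]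
  {M : VonNeumannAlgebra H} {ξ : H}

/-- The Hilbert-Schmidt condition is void on the one-dimensional space `ℂ`. -/
theorem Col_eq_OpM (F : Type*) [NormedAddCommGroup F] [InnerProductSpace ℂ F] :
    Col M ξ F = OpM M ξ ℂ F := by
  rw [Col, Mat, HS_complex, Submodule.comap_top, inf_top_eq]

theorem map_unitIdent (F : Type*) [NormedAddCommGroup F] [InnerProductSpace ℂ F] :
    (Col M ξ F).map (unitIdent M ξ F).toLinearMap = OpMXi M ξ F := by
  rw [Col_eq_OpM]
  have hu : ∀ u (hu : u ∈ M.commutant) (η : Xi M ξ) (h : ampl ℂ u (unitEquiv M ξ η : HT ℂ H) ∈ _),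
      (⟨ampl ℂ u (unitEquiv M ξ η : HT ℂ H), h⟩ : algTensor ℂ (Xi M ξ)) =
        unitEquiv M ξ ⟨u η, apply_mem_Xi M ξ hu η.2⟩ := fun u hu η h =>
    Subtype.ext (ampl_tmul u 1 (η : H))
  ext X
  constructor
  · rintro ⟨T, hT, rfl⟩ u hmu huu η
    have h1 := (hT u hmu huu (unitEquiv M ξ η)).2 (unitEquiv M ξ η).2
      (ampl_mem_algTensor hmu (unitEquiv M ξ η).2)
    rw [hu u hmu η] at h1
    exact h1
  · intro hX
    refine ⟨(unitIdent M ξ F).symm X, ?_, (unitIdent M ξ F).apply_symm_apply X⟩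
    intro u hmu huu z
    refine ⟨ampl_mem_iff M ξ hmu huu z, fun hz huz => ?_⟩
    obtain ⟨η, hη⟩ := (unitEquiv M ξ).surjective ⟨z, hz⟩
    have hη' : z = (unitEquiv M ξ η : HT ℂ H) := congrArg Subtype.val hη.symm
    subst hη'
    rw [hu u hmu η]
    have h2 : ∀ ζ : Xi M ξ, (unitIdent M ξ F).symm X (unitEquiv M ξ ζ) = X ζ := fun ζ =>
      congrArg X ((unitEquiv M ξ).symm_apply_apply ζ)
    rw [h2]
    exact (hX u hmu huu η).trans (h2 η).symm

/-- The lower left entry of an off-diagonal block matrix. -/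
theorem lower_offDiag (C : algTensor ℂ (Xi M ξ) →ₗ[ℂ] HT K H)
    (R : algTensor K (Xi M ξ) →ₗ[ℂ] HT ℂ H) :
    ampI H (prR ℂ K) ∘ₗ offDiag M ξ C R ∘ₗ algAmp (inL ℂ K) (Xi M ξ) = C := by
  refine LinearMap.ext fun z => ?_
  change htMap _ _ (htMap _ _ (R _) + htMap _ _ (C _)) = _
  rw [map_add, htMap_prR_inL, htMap_prR_inR, zero_add, algAmp_prL_inL]

/-- The upper right entry of an off-diagonal block matrix. -/
theorem upper_offDiag (C : algTensor ℂ (Xi M ξ) →ₗ[ℂ] HT K H)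
    (R : algTensor K (Xi M ξ) →ₗ[ℂ] HT ℂ H) :
    ampI H (prL ℂ K) ∘ₗ offDiag M ξ C R ∘ₗ algAmp (inR ℂ K) (Xi M ξ) = R := by
  refine LinearMap.ext fun z => ?_
  change htMap _ _ (htMap _ _ (R _) + htMap _ _ (C _)) = _
  rw [map_add, htMap_prL_inL, htMap_prL_inR, add_zero, algAmp_prR_inR]

theorem prL_stack (C D : algTensor ℂ (Xi M ξ) →ₗ[ℂ] HT K H) :
    ampI H (prL K K) ∘ₗ stack M ξ C D = C := by
  refine LinearMap.ext fun z => ?_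
  change htMap _ _ (htMap _ _ (C z) + htMap _ _ (D z)) = _
  rw [map_add, htMap_prL_inL, htMap_prL_inR, add_zero]

theorem prR_stack (C D : algTensor ℂ (Xi M ξ) →ₗ[ℂ] HT K H) :
    ampI H (prR K K) ∘ₗ stack M ξ C D = D := by
  refine LinearMap.ext fun z => ?_
  change htMap _ _ (htMap _ _ (C z) + htMap _ _ (D z)) = _
  rw [map_add, htMap_prR_inL, htMap_prR_inR, zero_add]

theorem stack_pr (X : algTensor ℂ (Xi M ξ) →ₗ[ℂ] HT (HSum K K) H) :
    stack M ξ (ampI H (prL K K) ∘ₗ X) (ampI H (prR K K) ∘ₗ X) = X :=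
  LinearMap.ext fun z => htMap_inL_prL_add (X z)

theorem sumFlip_stack (C D : algTensor ℂ (Xi M ξ) →ₗ[ℂ] HT K H) :
    ampI H (sumFlip K) ∘ₗ stack M ξ C D = stack M ξ D C := by
  refine LinearMap.ext fun z => ?_
  change htMap _ _ (htMap _ _ (C z) + htMap _ _ (D z)) = htMap _ _ (D z) + htMap _ _ (C z)
  rw [map_add, htMap_sumFlip_inL, htMap_sumFlip_inR, add_comm]

/-- An off-diagonal block matrix corresponds to its pair of entries. -/
def matZeroEquiv : (Col M ξ K × Row M ξ K) ≃ₗ[ℂ] MatZero M ξ K :=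
  LinearEquiv.ofBijective
    ({ toFun := fun p => ⟨offDiag M ξ p.1.1 p.2.1, offDiag_mem M ξ p.1.2 p.2.2⟩
       map_add' := fun p q => Subtype.ext (offDiag_add M ξ p.1.1 q.1.1 p.2.1 q.2.1)
       map_smul' := fun a p => Subtype.ext (offDiag_smul M ξ a p.1.1 p.2.1) } :
      (Col M ξ K × Row M ξ K) →ₗ[ℂ] MatZero M ξ K)
    ⟨fun p q h => by
      have h1 : offDiag M ξ p.1.1 p.2.1 = offDiag M ξ q.1.1 q.2.1 := congrArg Subtype.val h
      refine Prod.ext (Subtype.ext ?_) (Subtype.ext ?_)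
      · rw [← lower_offDiag p.1.1 p.2.1, h1, lower_offDiag]
      · rw [← upper_offDiag p.1.1 p.2.1, h1, upper_offDiag],
    fun ⟨_, C, hC, R, hR, h⟩ => ⟨(⟨C, hC⟩, ⟨R, hR⟩), Subtype.ext h.symm⟩⟩

theorem stack_mem [CompleteSpace K] {C D : algTensor ℂ (Xi M ξ) →ₗ[ℂ] HT K H}
    (hC : C ∈ Col M ξ K) (hD : D ∈ Col M ξ K) : stack M ξ C D ∈ Col M ξ (HSum K K) :=
  add_mem (Mat_comp_left hC _) (Mat_comp_left hD _)

/-- A column with values in a direct sum corresponds to its pair of components. -/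
def stackEquiv [CompleteSpace K] : (Col M ξ K × Col M ξ K) ≃ₗ[ℂ] Col M ξ (HSum K K) where
  toFun p := ⟨stack M ξ p.1.1 p.2.1, stack_mem p.1.2 p.2.2⟩
  map_add' p q := Subtype.ext <| by
    change stack M ξ (p.1.1 + q.1.1) (p.2.1 + q.2.1) =
      stack M ξ p.1.1 p.2.1 + stack M ξ q.1.1 q.2.1
    simp only [stack, LinearMap.comp_add]
    abel
  map_smul' a p := Subtype.ext <| by
    change stack M ξ (a • p.1.1) (a • p.2.1) = a • stack M ξ p.1.1 p.2.1
    simp only [stack, LinearMap.comp_smul, smul_add]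
  invFun X := (⟨ampI H (prL K K) ∘ₗ X.1, Mat_comp_left X.2 _⟩,
    ⟨ampI H (prR K K) ∘ₗ X.1, Mat_comp_left X.2 _⟩)
  left_inv p := Prod.ext (Subtype.ext (prL_stack _ _)) (Subtype.ext (prR_stack _ _))
  right_inv X := Subtype.ext (stack_pr X.1)

theorem formalDagger_offDiag {C : algTensor ℂ (Xi M ξ) →ₗ[ℂ] HT K H}
    {R : algTensor K (Xi M ξ) →ₗ[ℂ] HT ℂ H} {C' : algTensor K (Xi M ξ) →ₗ[ℂ] HT ℂ H}
    {R' : algTensor ℂ (Xi M ξ) →ₗ[ℂ] HT K H} (hC : FormalDagger C C') (hR : FormalDagger R R') :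
    FormalDagger (offDiag M ξ C R) (offDiag M ξ R' C') := by
  -- Taking adjoints exchanges the two off-diagonal positions, so the summand with `C` has to come
  -- first to match the upper right entry.
  rw [offDiag, add_comm]
  exact ((hC.comp_right inner_inL).comp_left inner_inR).add
    ((hR.comp_right inner_inR).comp_left inner_inL)

theorem offDiag_mem_Mat [CompleteSpace K] {C : algTensor ℂ (Xi M ξ) →ₗ[ℂ] HT K H}
    {R : algTensor K (Xi M ξ) →ₗ[ℂ] HT ℂ H} (hC : C ∈ Col M ξ K) (hR : R ∈ Row M ξ K) :
    offDiag M ξ C R ∈ Mat M ξ (Hat K) (Hat K) :=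
  add_mem (Mat_comp_left (Mat_comp_right hR _) _) (Mat_comp_left (Mat_comp_right hC _) _)

variable [IsCyclicSeparating M ξ] [CompleteSpace K]

/-- The column map `[[0, R], [C, 0]] ↦ [C; R^⊤]`. -/
def colEquiv (k : Conjugation K) : MatZero M ξ K ≃ₗ[ℂ] Col M ξ (HSum K K) :=
  matZeroEquiv.symm ≪≫ₗ
    LinearEquiv.prodCongr (LinearEquiv.refl ℂ _) (matTransposeEquiv k conjC) ≪≫ₗ stackEquiv

theorem colEquiv_offDiag (k : Conjugation K) (C : Col M ξ K) (R : Row M ξ K) :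
    (colEquiv k ⟨offDiag M ξ C.1 R.1, offDiag_mem M ξ C.2 R.2⟩).1 =
      stack M ξ C.1 (matTranspose M ξ k conjC R) := by
  have h : matZeroEquiv.symm ⟨offDiag M ξ C.1 R.1, offDiag_mem M ξ C.2 R.2⟩ = (C, R) := by
    rw [LinearEquiv.symm_apply_eq]
    rfl
  rw [colEquiv, LinearEquiv.trans_apply, LinearEquiv.trans_apply, h]
  rfl

/-- The entries are compressions of the block matrix by coordinate maps and embeddings, and such
compressions preserve adjointability. -/
theorem offDiag_mem_MatDag_iff {C : algTensor ℂ (Xi M ξ) →ₗ[ℂ] HT K H}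
    {R : algTensor K (Xi M ξ) →ₗ[ℂ] HT ℂ H} :
    offDiag M ξ C R ∈ MatDag M ξ (Hat K) (Hat K) ↔
      C ∈ MatDag M ξ ℂ K ∧ R ∈ MatDag M ξ K ℂ := by
  constructor
  · intro h
    constructor
    · rw [← lower_offDiag C R]
      exact MatDag_comp_left (MatDag_comp_right h inner_prL) inner_prR
    · rw [← upper_offDiag C R]
      exact MatDag_comp_left (MatDag_comp_right h inner_prR) inner_prL
  · rintro ⟨hC, hR⟩
    exact (formalDagger_offDiag (formalDagger_matDagger ⟨C, hC⟩)
      (formalDagger_matDagger ⟨R, hR⟩)).mem_MatDag (offDiag_mem_Mat hC.1 hR.1)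
      (offDiag_mem_Mat (matDagger M ξ ⟨R, hR⟩).2 (matDagger M ξ ⟨C, hC⟩).2)

theorem stack_mem_MatDag_iff {C D : algTensor ℂ (Xi M ξ) →ₗ[ℂ] HT K H} :
    stack M ξ C D ∈ ColDag M ξ (HSum K K) ↔ C ∈ ColDag M ξ K ∧ D ∈ ColDag M ξ K := by
  constructor
  · intro h
    constructor
    · rw [← prL_stack C D]
      exact MatDag_comp_left h inner_prL
    · rw [← prR_stack C D]
      exact MatDag_comp_left h inner_prR
  · rintro ⟨hC, hD⟩
    exact add_mem (MatDag_comp_left hC inner_inL) (MatDag_comp_left hD inner_inR)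

theorem mem_MatZeroDag_iff_colEquiv (k : Conjugation K) (T : MatZero M ξ K) :
    T.1 ∈ MatZeroDag M ξ K ↔ (colEquiv k T).1 ∈ ColDag M ξ (HSum K K) := by
  obtain ⟨_, C, hC, R, hR, rfl⟩ := T
  rw [colEquiv_offDiag k ⟨C, hC⟩ ⟨R, hR⟩, stack_mem_MatDag_iff]
  have h1 : offDiag M ξ C R ∈ MatZeroDag M ξ K ↔ offDiag M ξ C R ∈ MatDag M ξ (Hat K) (Hat K) :=
    and_iff_right (offDiag_mem M ξ hC hR)
  rw [h1, offDiag_mem_MatDag_iff]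
  exact and_congr_right fun _ => ⟨fun h => matTranspose_mem_MatDag (T := ⟨R, hR⟩) k conjC h,
    fun h => mem_MatDag_of_matTranspose (T := ⟨R, hR⟩) k conjC h⟩

/-- Each embedding is adjoint to a coordinate map and commutes with the componentwise conjugations,
so the two entries are transposed and change places. -/
theorem matTranspose_offDiag (k : Conjugation K) (C : Col M ξ K) (R : Row M ξ K) :
    matTranspose M ξ (conjC.sum k) (conjC.sum k)
      ⟨offDiag M ξ C.1 R.1, offDiag_mem_Mat C.2 R.2⟩ =
      offDiag M ξ (matTranspose M ξ k conjC R) (matTranspose M ξ conjC k C) := by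
  have e : (⟨offDiag M ξ C.1 R.1, offDiag_mem_Mat C.2 R.2⟩ : Mat M ξ (Hat K) (Hat K)) =
      ⟨_, Mat_comp_left (Mat_comp_right R.2 (prR ℂ K)) (inL ℂ K)⟩ +
        ⟨_, Mat_comp_left (Mat_comp_right C.2 (prL ℂ K)) (inR ℂ K)⟩ := rfl
  rw [e, matTranspose_add,
    matTranspose_comp_left (conjC.sum k) conjC (conjC.sum k)
      ⟨_, Mat_comp_right R.2 (prR ℂ K)⟩ inner_inL (fun _ => rfl),
    matTranspose_comp_left (conjC.sum k) k (conjC.sum k)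
      ⟨_, Mat_comp_right C.2 (prL ℂ K)⟩ inner_inR (fun _ => rfl),
    matTranspose_comp_right k conjC (conjC.sum k) R inner_inR (fun _ => rfl),
    matTranspose_comp_right conjC k (conjC.sum k) C inner_inL (fun _ => rfl), offDiag, add_comm]
  rfl

/-- The conjugate of a column is computed componentwise. -/
theorem matConj_stack (k : Conjugation K) {C D : algTensor ℂ (Xi M ξ) →ₗ[ℂ] HT K H}
    (hC : C ∈ ColDag M ξ K) (hD : D ∈ ColDag M ξ K) :
    matConj M ξ conjC (k.sum k) ⟨stack M ξ C D, stack_mem_MatDag_iff.2 ⟨hC, hD⟩⟩ =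
      stack M ξ (matConj M ξ conjC k ⟨C, hC⟩) (matConj M ξ conjC k ⟨D, hD⟩) := by
  have e : matDagger M ξ ⟨stack M ξ C D, stack_mem_MatDag_iff.2 ⟨hC, hD⟩⟩ =
      ⟨_, Mat_comp_right (matDagger M ξ ⟨C, hC⟩).2 (prL K K)⟩ +
        ⟨_, Mat_comp_right (matDagger M ξ ⟨D, hD⟩).2 (prR K K)⟩ :=
    Subtype.ext <| FormalDagger.matDagger_eq <|
      ((formalDagger_matDagger ⟨C, hC⟩).comp_left inner_inL).add
        ((formalDagger_matDagger ⟨D, hD⟩).comp_left inner_inR)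
  rw [matConj, e, matTranspose_add,
    matTranspose_comp_right k conjC (k.sum k) _ inner_inL (fun _ => rfl),
    matTranspose_comp_right k conjC (k.sum k) _ inner_inR (fun _ => rfl)]
  rfl

/-- The conjugate of the transpose is the adjoint. -/
theorem matConj_matTranspose {E : Type*} [NormedAddCommGroup E] [InnerProductSpace ℂ E]
    [CompleteSpace E] {F : Type*} [NormedAddCommGroup F] [InnerProductSpace ℂ F] [CompleteSpace F]
    (k₁ : Conjugation E) (k₂ : Conjugation F) {T : Mat M ξ E F} (hT : T.1 ∈ MatDag M ξ E F) :
    matConj M ξ k₂ k₁ ⟨matTranspose M ξ k₁ k₂ T, matTranspose_mem_MatDag k₁ k₂ hT⟩ =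
      (matDagger M ξ ⟨T.1, hT⟩).1 := by
  -- The adjoint of `T^⊤` is `T̄`, itself the transpose of `T†`; the outer transpose undoes it.
  have e : matDagger M ξ ⟨matTranspose M ξ k₁ k₂ T, matTranspose_mem_MatDag k₁ k₂ hT⟩ =
      ⟨matTranspose M ξ k₂ k₁ (matDagger M ξ ⟨T.1, hT⟩), matTranspose_mem k₂ k₁ _⟩ :=
    Subtype.ext (FormalDagger.matDagger_eq (formalDagger_matConj k₁ k₂ ⟨T.1, hT⟩).symm)
  rw [matConj, e, matTranspose_matTranspose]

end Column

/-! ### The domain of `k^π ⊗ S_ξ` -/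

section Domain

variable {H : Type v} [NormedAddCommGroup H] [InnerProductSpace ℂ H] [CompleteSpace H]
  {M : VonNeumannAlgebra H} {ξ : H}

theorem conjAlgTensor_apply {E E' X Y : Type*} [NormedAddCommGroup E] [InnerProductSpace ℂ E]
    [NormedAddCommGroup E'] [InnerProductSpace ℂ E'] [NormedAddCommGroup X]
    [InnerProductSpace ℂ X] [NormedAddCommGroup Y] [InnerProductSpace ℂ Y]
    (J : E →ₗ⋆[ℂ] E') (A : X →ₛₗ.[starRingEnd ℂ] Y) (t : E ⊗[ℂ] A.domain) :
    conjAlgTensor J A (algTensorEquiv E A.domain t) =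
      toHT E' Y (TensorProduct.map J A.toFun t) :=
  congrArg (fun t => toHT E' Y (TensorProduct.map J A.toFun t))
    ((algTensorEquiv E A.domain).symm_apply_apply t)

theorem mem_graph_conjAlgTensor {E E' X Y : Type*} [NormedAddCommGroup E]
    [InnerProductSpace ℂ E] [NormedAddCommGroup E'] [InnerProductSpace ℂ E']
    [NormedAddCommGroup X] [InnerProductSpace ℂ X] [NormedAddCommGroup Y] [InnerProductSpace ℂ Y]
    (J : E →ₗ⋆[ℂ] E') {A : X →ₛₗ.[starRingEnd ℂ] Y} (c : E) {v : X} {w : Y}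
    (h : (v, w) ∈ conjGraph A) : (tmul c v, tmul (J c) w) ∈ conjGraph (conjAlgTensor J A) := by
  obtain ⟨hv, hw⟩ := h
  exact ⟨tmul_mem_algTensor A.domain c hv,
    (conjAlgTensor_apply J A (c ⊗ₜ ⟨v, hv⟩)).trans (congrArg (tmul (J c)) hw)⟩

theorem unitVec_eq : unitVec M ξ = Evec M ξ ℂ 1 := rfl

variable [IsCyclicSeparating M ξ]
  {F : Type*} [NormedAddCommGroup F] [InnerProductSpace ℂ F]
  {F' : Type*} [NormedAddCommGroup F'] [InnerProductSpace ℂ F']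

/-- `J' ⊗ (xξ ↦ x*ξ)`, for `x ∈ M'`, is a formal adjoint on the dense space `F' ⊙ Ξ`. A limit `(0,
y)` of graph points therefore has `y = 0`. -/
theorem conjClosable_conjAlgTensor_tomita {J : F →ₗ⋆[ℂ] F'} {J' : F' →ₗ⋆[ℂ] F}
    (hJ : ∀ c d, ⟪d, J c⟫_ℂ = ⟪c, J' d⟫_ℂ) :
    ConjClosable (conjAlgTensor J (tomita M ξ)) := by
  intro y hy
  have h1 : ∀ (d : F') (x : H →L[ℂ] H), x ∈ M.commutant → ⟪y, tmul d (x ξ)⟫_ℂ = 0 := by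
    intro d x hx
    have hcl : IsClosed {p : HT F H × HT F' H |
        ⟪tmul d (x ξ), p.2⟫_ℂ = ⟪p.1, tmul (J' d) ((star x) ξ)⟫_ℂ} :=
      isClosed_eq (by fun_prop) (by fun_prop)
    have h2 : ((0 : HT F H), y) ∈ {p : HT F H × HT F' H |
        ⟪tmul d (x ξ), p.2⟫_ℂ = ⟪p.1, tmul (J' d) ((star x) ξ)⟫_ℂ} := by
      refine closure_minimal ?_ hcl hy
      rintro ⟨z, z'⟩ ⟨hz, hz'⟩
      change z ∈ algTensor F (tomita M ξ).domain at hz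
      obtain ⟨t, ht⟩ := (algTensorEquiv F (tomita M ξ).domain).surjective ⟨z, hz⟩
      have hz1 : z = toHT F H ((tomita M ξ).domain.subtype.lTensor F t) :=
        congrArg Subtype.val ht.symm
      have hz2 : z' = toHT F' H (TensorProduct.map J (tomita M ξ).toFun t) := by
        rw [← conjAlgTensor_apply, ht]
        exact hz'.symm
      change ⟪tmul d (x ξ), z'⟫_ℂ = ⟪z, tmul (J' d) ((star x) ξ)⟫_ℂ
      rw [hz1, hz2]
      clear * - hJ hx
      induction t using TensorProduct.induction_on with
      | zero => simp
      | tmul c v =>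
        change ⟪tmul d (x ξ), tmul (J c) (tomita M ξ v)⟫_ℂ =
          ⟪tmul c (v : H), tmul (J' d) ((star x) ξ)⟫_ℂ
        rw [inner_tmul, inner_tmul, hJ, inner_of_mem_closure_graph_tomitaPre M ξ
          ((mem_graph_tomita M ξ).1 ⟨v.2, rfl⟩) hx]
      | add a b ha hb => simp only [map_add, inner_add_left, inner_add_right, ha, hb]
    rw [← inner_conj_symm, h2, inner_zero_left, map_zero]
  have h3 : (innerₛₗ ℂ y) ∘ₗ (algTensor F' (Xi M ξ)).subtype = 0 := by
    refine algTensor_hom_ext fun d v hv => ?_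
    obtain ⟨x, hx, rfl⟩ := mem_orbit.1 hv
    exact h1 d x hx
  exact (dense_algTensor_Xi (E := F') (M := M) (ξ := ξ)).eq_zero_of_inner_left ℂ fun z hz =>
    congrArg (fun A => A ⟨z, hz⟩) h3

variable [CompleteSpace F]

/-- Formal adjointness of `X` and `X†`, tested on `1 ⊗ ξ` and `e ⊗ x*yξ` with `x, y ∈ M'`, is
exactly the hypothesis of `mem_closure_graph_tomitaPre`. The conjugate `ē` appears because
transposing `X†` conjugates the slicing vector. -/
theorem mem_graph_tomita_slice (k : Conjugation F) (X : ColDag M ξ F) (e : F) :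
    (slice H e (X.1 (unitVec M ξ)),
      slice H (k.conj e) (matConj M ξ conjC k X (unitVec M ξ))) ∈ conjGraph (tomita M ξ) := by
  refine (mem_graph_tomita M ξ).2 (mem_closure_graph_tomitaPre M ξ fun x hx y hy => ?_)
  have hxy : star x * y ∈ M.commutant := mul_mem (star_mem hx) hy
  have hm : (star x * y) ξ ∈ Xi M ξ := mem_orbit.2 ⟨_, hxy, rfl⟩
  rw [unitVec_eq, matConj, slice_matTranspose, k.conj_conj]
  have h1 : (conjC.conj 1 : ℂ) = 1 := star_one ℂ
  rw [h1, ← ContinuousLinearMap.adjoint_inner_right]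
  change ⟪_, (star x * y) ξ⟫_ℂ = _
  rw [inner_slice]
  have h2 := (formalDagger_matDagger X).symm (Evec M ξ ℂ 1)
    ⟨tmul e ((star x * y) ξ), tmul_mem_algTensor _ e hm⟩
  rw [h2, OpM_apply_tmul (matDagger M ξ X).2.1 hxy e rfl hm, ← inner_conj_symm, inner_ampl,
    inner_conj_symm, star_mul, star_star]
  change ⟪ampl ℂ (star y * x) (tmul 1 ξ), _⟫_ℂ = _
  rw [ampl_tmul, ← inner_tmul_slice]
  exact ContinuousLinearMap.adjoint_inner_left y _ _

/-- `Xξ` is expanded along `(eᵢ)` and `X̄ξ` along `(ēᵢ)`. Since `J eᵢ = A ēᵢ`, corresponding terms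
form a pair in the graph of `J ⊙ S_ξ`, and the partial sums converge in the closed graph. Factoring
`J` through the linear map `A` allows `A ⊗ I` to be applied as a bounded operator. -/
theorem mem_graph_conjTensor_tomita (k : Conjugation F) (X : ColDag M ξ F) {J : F →ₗ⋆[ℂ] F'}
    {J' : F' →ₗ⋆[ℂ] F} (hJ : ∀ c d, ⟪d, J c⟫_ℂ = ⟪c, J' d⟫_ℂ) {A : F →L[ℂ] F'}
    (hA : ∀ c, J c = A (k.conj c)) :
    (X.1 (unitVec M ξ), htMap A (.id ℂ H) (matConj M ξ conjC k X (unitVec M ξ))) ∈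
      conjGraph (conjTensor J (tomita M ξ)) := by
  rw [conjTensor, mem_conjGraph_conjClosure (conjClosable_conjAlgTensor_tomita hJ)]
  have h1 := hasSum_tmul_slice (stdBasis F) (X.1 (unitVec M ξ))
  have h2 := (hasSum_tmul_slice (HilbertBasis_conj k (stdBasis F))
    (matConj M ξ conjC k X (unitVec M ξ))).mapL (htMap A (.id ℂ H))
  refine isClosed_closure.mem_of_tendsto (h1.prodMk h2) (Filter.Eventually.of_forall fun s => ?_)
  refine Finset.sum_induction _ (· ∈ closure (conjGraph (conjAlgTensor J (tomita M ξ))))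
    (fun _ _ => conjGraph_closure_add _) (conjGraph_closure_zero _) fun i _ => ?_
  refine subset_closure ?_
  have h3 := mem_graph_conjAlgTensor J (stdBasis F i) (mem_graph_tomita_slice k X (stdBasis F i))
  rw [hA] at h3
  rw [htMap_tmul, HilbertBasis_conj_apply]
  exact h3

end Domain

end AffMat

end

/-! ### Assembly of the theorem -/

theorem mainTheorem8 {H : Type*} [NormedAddCommGroup H] [InnerProductSpace ℂ H] [CompleteSpace H]
    (M : VonNeumannAlgebra H) (ξ : H) [IsCyclicSeparating M ξ]
    {K : Type*} [NormedAddCommGroup K] [InnerProductSpace ℂ K] [CompleteSpace K]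
    (k : Conjugation K) :
    -- the column space of `k ⊕ k` is `Op_M(Ξ; (k ⊕ k) ⊗ H)`
    Col M ξ (HSum K K) = OpM M ξ ℂ (HSum K K) ∧
    (Col M ξ (HSum K K)).map (unitIdent M ξ (HSum K K)).toLinearMap = OpMXi M ξ (HSum K K) ∧
    -- the column map is a linear isomorphism
    ∃ col : MatZero M ξ K ≃ₗ[ℂ] Col M ξ (HSum K K),
      (∀ (C : Col M ξ K) (R : Row M ξ K),
        (col ⟨offDiag M ξ C.1 R.1, offDiag_mem M ξ C.2 R.2⟩).1 =
          stack M ξ C.1 (matTranspose M ξ k conjC R)) ∧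
      -- which restricts to an isomorphism of the adjointable spaces
      ((MatZeroDag M ξ K).comap (MatZero M ξ K).subtype).map col.toLinearMap =
        (ColDag M ξ (HSum K K)).comap (Col M ξ (HSum K K)).subtype ∧
      -- and is compatible with the adjoint and the conjugate
      ∀ (T : MatZero M ξ K) (hT : T.1 ∈ MatDag M ξ (Hat K) (Hat K)),
        ∃ (hdag : (matDagger M ξ ⟨T.1, hT⟩).1 ∈ MatZeroDag M ξ K)
          (hconj : matConj M ξ (conjC.sum k) (conjC.sum k) ⟨T.1, hT⟩ ∈ MatZeroDag M ξ K)
          (hcol : (col T).1 ∈ ColDag M ξ (HSum K K)),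
          (col ⟨_, hdag.1⟩).1 = ampI H (sumFlip K) ∘ₗ (col ⟨_, hconj.1⟩).1 ∧
          (col ⟨_, hconj.1⟩).1 = matConj M ξ conjC (k.sum k) ⟨(col T).1, hcol⟩ ∧
          ∃ hdom : (col T).1 (unitVec M ξ) ∈ (conjTensor k.pi (tomita M ξ)).domain,
            (col ⟨_, hdag.1⟩).1 (unitVec M ξ) =
              conjTensor k.pi (tomita M ξ) ⟨(col T).1 (unitVec M ξ), hdom⟩ := by

  refine ⟨Col_eq_OpM _, map_unitIdent _, colEquiv k, colEquiv_offDiag k, ?_, fun T hT => ?_⟩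
  · ext X
    constructor
    · rintro ⟨T, hT, rfl⟩
      exact (mem_MatZeroDag_iff_colEquiv k T).1 hT
    · intro hX
      obtain ⟨T, rfl⟩ := (colEquiv k).surjective X
      exact ⟨T, (mem_MatZeroDag_iff_colEquiv k T).2 hX, rfl⟩
  · have hcol := (mem_MatZeroDag_iff_colEquiv k T).1 ⟨T.2, hT⟩
    obtain ⟨_, C, hC, R, hR, rfl⟩ := T
    obtain ⟨hC', hR'⟩ := offDiag_mem_MatDag_iff.1 hT
    let Cd : Row M ξ K := matDagger M ξ ⟨C, hC'⟩
    let Rd : Col M ξ K := matDagger M ξ ⟨R, hR'⟩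
    let Cc : Col M ξ K := ⟨matTranspose M ξ k conjC Cd, matTranspose_mem k conjC Cd⟩
    let Rc : Row M ξ K := ⟨matTranspose M ξ conjC k Rd, matTranspose_mem conjC k Rd⟩
    -- `T†` has lower left entry `R†` and upper right entry `C†`; transposing it in `econj`
    -- interchanges the positions again.
    have edag : (matDagger M ξ ⟨offDiag M ξ C R, hT⟩).1 = offDiag M ξ Rd.1 Cd.1 :=
      FormalDagger.matDagger_eq <| formalDagger_offDiag (formalDagger_matDagger ⟨C, hC'⟩)
        (formalDagger_matDagger ⟨R, hR'⟩)
    have econj : matConj M ξ (conjC.sum k) (conjC.sum k) ⟨offDiag M ξ C R, hT⟩ =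
        offDiag M ξ Cc.1 Rc.1 := by
      have e : matDagger M ξ ⟨offDiag M ξ C R, hT⟩ =
          ⟨offDiag M ξ Rd.1 Cd.1, offDiag_mem_Mat Rd.2 Cd.2⟩ := Subtype.ext edag
      rw [matConj, e, matTranspose_offDiag]
    have hdag : (matDagger M ξ ⟨offDiag M ξ C R, hT⟩).1 ∈ MatZeroDag M ξ K :=
      ⟨edag ▸ offDiag_mem M ξ Rd.2 Cd.2, matDagger_mem_MatDag _⟩
    have hconj : matConj M ξ (conjC.sum k) (conjC.sum k) ⟨offDiag M ξ C R, hT⟩ ∈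
        MatZeroDag M ξ K :=
      ⟨econj ▸ offDiag_mem M ξ Cc.2 Rc.2, matConj_mem_MatDag _ _ _⟩
    have cdag : (colEquiv k ⟨_, hdag.1⟩).1 = stack M ξ Rd.1 Cc.1 := by
      rw [← colEquiv_offDiag k Rd Cd]
      congr 2
      exact Subtype.ext edag
    -- The column map transposes the entry `R̄ = (R†)^⊤` back to `R†`.
    have cconj : (colEquiv k ⟨_, hconj.1⟩).1 = stack M ξ Cc.1 Rd.1 := by
      have e : matTranspose M ξ k conjC Rc = Rd.1 := matTranspose_matTranspose conjC k Rd
      rw [← e, ← colEquiv_offDiag k Cc Rc]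
      congr 2
      exact Subtype.ext econj
    have cT := colEquiv_offDiag k ⟨C, hC⟩ ⟨R, hR⟩
    have hRt : matTranspose M ξ k conjC ⟨R, hR⟩ ∈ ColDag M ξ K :=
      matTranspose_mem_MatDag (T := ⟨R, hR⟩) k conjC hR'
    have cconj' : matConj M ξ conjC (k.sum k) ⟨_, hcol⟩ = stack M ξ Cc.1 Rd.1 := by
      have e : (⟨_, hcol⟩ : ColDag M ξ (HSum K K)) =
          ⟨stack M ξ C (matTranspose M ξ k conjC ⟨R, hR⟩),
            stack_mem_MatDag_iff.2 ⟨hC', hRt⟩⟩ := Subtype.ext cT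
      rw [e, matConj_stack k hC' hRt, matConj_matTranspose k conjC (T := ⟨R, hR⟩) hR']
      rfl
    -- `k^π` is self-adjoint in the conjugate-linear sense, because the flip is self-adjoint and
    -- commutes with `k ⊕ k`. So it serves as its own `J'`.
    have hJ : ∀ c d, ⟪d, k.pi c⟫_ℂ = ⟪c, k.pi d⟫_ℂ := fun c d => by
      change ⟪d, (k.sum k).conj (sumFlip K c)⟫_ℂ = ⟪c, (k.sum k).conj (sumFlip K d)⟫_ℂ
      rw [← inner_conj_symm, (k.sum k).inner_conj_left, inner_conj_symm, ← sumFlip_conj,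
        ← inner_sumFlip]
    have hgraph := mem_graph_conjTensor_tomita (k.sum k) ⟨_, hcol⟩ hJ
      (A := sumFlip K) (fun c => (sumFlip_conj k c).symm)
    -- The second component of the graph point is the flip of the conjugate column, which is `(col
    -- T†)ξ`.
    have hflip : htMap (sumFlip K) (.id ℂ H) (stack M ξ Cc.1 Rd.1 (unitVec M ξ)) =
        stack M ξ Rd.1 Cc.1 (unitVec M ξ) :=
      congrArg (fun X => X (unitVec M ξ)) (sumFlip_stack Cc.1 Rd.1)
    rw [cconj', hflip] at hgraph
    obtain ⟨hdom, hval⟩ := hgraph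
    refine ⟨hdag, hconj, hcol, ?_, cconj.trans cconj'.symm, hdom, ?_⟩
    · rw [cdag, cconj, sumFlip_stack]
    · exact (congrArg (fun X => X (unitVec M ξ)) cdag).trans hval.symm
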